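/- Fix an integer $N\ge 1$. Let $\mathfrak A$ be the quasi-local (UHF) $C^*$-algebra of the chain $\mathbb Z$ with on-site algebra $M_N(\mathbb C)$, i.e. the norm closure of the union of the local algebras $\mathfrak A_{[x,y]}=\bigotimes_{z=x}^{y}M_N(\mathbb C)$; let $\eta_x$ denote translation by $x$, write $a_x=\eta_x(a)$, and let $\omega$ be the tracial (infinite-temperature) state on $\mathfrak A$. Let $h=h^*\in\mathfrak A_{[0,d_h-1]}$ be an interaction and, for a finite interval $\Lambda=[a,b]$, put $H_\Lambda=\sum_{x=a}^{b-d_h+1}h_x$ and $\tau^\Lambda_t(A)=e^{itH_\Lambda}Ae^{-itH_\Lambda}$. Let $j=j^*\in\mathfrak A_{[0,d_j-1]}$ be a current density with $\omega(j)=0$, let $\Lambda_n=[1,n]$ and $J_{\Lambda_n}=\sum_{x=1}^{n-d_j+1}j_x$. Let $Q_{\Lambda_n}=Q_{\Lambda_n}^*\in\mathfrak A_{[1,n]}$ $(n\ge 0)$ be almost conserved: there are $d_b$ and a local operator $b\in\mathfrak A_{[0,d_b-1]}$, independent of $n$, with $$[H_{\Lambda_n},Q_{\Lambda_n}]=b_1-b_{n-d_b+1}\qquad\text{for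 all } n\ge d_b .$$ Let $\beta\ge 0$. Then: 1. For all $t\in\mathbb R$ and $A\in\mathfrak A$ the norm limit $\tau_t(A)=\lim_{\Lambda\to\mathbb Z}\tau_t^\Lambda(A)$ exists and lies in $\mathfrak A$. 2. For every $t$ the limit $$C(t)=\lim_{n\to\infty}\frac1n\,\omega\big(J_{\Lambda_n}\tau_t(J_{\Lambda_n})\big)=\sum_{x\in\mathbb Z}\omega\big(j_x\tau_t(j_0)\big)$$ exists and is real, $C$ is continuous, and the limit defining the high-temperature Drude weight (thermodynamic limit first, time limit second), $$D^{\rm th}_0=\lim_{t\to\infty}\frac{\beta}{2t}\int_0^t C(t')\,dt',$$ exists. 3. With the convention $0/0=0$, the sequence $\frac1n\,\omega(J_{\Lambda_n}Q_{\Lambda_n})^2/\omega(Q_{\Lambda_n}^2)$ is bounded above and $$D^{\rm th}_0\;\ge\;\frac{\beta}{2}\,\limsup_{n\to\infty}\frac1n\,\frac{\omega(J_{\Lambda_n}Q_{\Lambda_n})^2}{\omega(Q_{\Lambda_n}^2)} .$$ 4. Suppose moreover that $Q$ is pseudo-local: $Q_{\Lambda_n}=\sum_{d=1}^n\sum_{x=1}^{n-d+1}q^{(d)}_x$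 for all $n$, with $q^{(d)}=(q^{(d)})^*\in\mathfrak A_{[0,d-1]}$, $\omega(q^{(d)})=0$ and $\omega((q^{(d)})^2)\le\zeta e^{-\xi d}$ for constants $\zeta,\xi>0$. Then the limits $r=\lim_n\frac1n\omega(J_{\Lambda_n}Q_{\Lambda_n})$ and $\chi=\lim_n\frac1n\omega(Q_{\Lambda_n}^2)$ exist and are real, and if $\chi\ne 0$, then the sequence in 3 converges, to $r^2/\chi$, so that $$D^{\rm th}_0\;\ge\;\frac{\beta}{2}\,\lim_{n\to\infty}\frac1n\,\frac{\omega(J_{\Lambda_n}Q_{\Lambda_n})^2}{\omega(Q_{\Lambda_n}^2)} .$$ -/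

import Mathlib

open Filter Topology MeasureTheory
open scoped BigOperators

noncomputable section

namespace SpinChain

/-- Configurations of a chain of `N`-level systems, one on each site of `ℤ`. -/
abbrev Config (N : ℕ) : Type := ℤ → Fin N

/-- The Hilbert space with orthonormal basis indexed by all configurations. -/
abbrev Hil (N : ℕ) : Type := lp (fun _ : Config N => ℂ) 2

/-- Bounded operators on `Hil N`, a C*-algebra in which all observables live. -/
abbrev Op (N : ℕ) : Type := Hil N →L[ℂ] Hil N

/-- Matrices on `d` sites: the algebra `⊗^d M_N(ℂ)`. -/
abbrev LocalMatrix (N d : ℕ) : Type := Matrix (Fin d → Fin N) (Fin d → Fin N) ℂ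

/-- The restriction of a configuration to the sites `x, …, x + d - 1`. -/
def window {N : ℕ} (d : ℕ) (x : ℤ) (s : Config N) : Fin d → Fin N :=
  fun k => s (x + (k : ℕ))

/-- The configuration `s`, replaced by `v` on the sites `x, …, x + d - 1`. -/
def overwrite {N d : ℕ} (x : ℤ) (v : Fin d → Fin N) (s : Config N) : Config N :=
  fun i => if hi : 0 ≤ i - x ∧ i - x < d then v ⟨(i - x).toNat, by omega⟩ else s i

theorem overwrite_window_injective {N d : ℕ} (x : ℤ) (v : Fin d → Fin N) :
    Function.Injective fun s : Config N => (overwrite x v s, window d x s) := by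
  intro s s' hs
  simp only [Prod.mk.injEq] at hs
  funext i
  by_cases hi : 0 ≤ i - x ∧ i - x < d
  · have h2 := congrFun hs.2 ⟨(i - x).toNat, by omega⟩
    have h3 : x + (((i - x).toNat : ℕ) : ℤ) = i := by omega
    simpa only [window, h3] using h2
  · have h1 := congrFun hs.1 i
    simpa only [overwrite, dif_neg hi] using h1

theorem memℓp_overwrite {N d : ℕ} (x : ℤ) (v : Fin d → Fin N) (c : (Fin d → Fin N) → ℂ)
    (f : Hil N) :
    Memℓp (fun s : Config N => c (window d x s) * f (overwrite x v s)) 2 := by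
  have h2 : (0 : ℝ) < (2 : ENNReal).toReal := by norm_num
  refine memℓp_gen ?_
  have hf : Summable fun s : Config N => ‖f s‖ ^ (2 : ENNReal).toReal :=
    (memℓp_gen_iff h2).1 (lp.memℓp f)
  have hc : Summable fun w : Fin d → Fin N => ‖c w‖ ^ (2 : ENNReal).toReal :=
    (hasSum_fintype _).summable
  have hp := Summable.mul_of_nonneg hf hc (fun _ => by positivity) (fun _ => by positivity)
  have hq := hp.comp_injective (overwrite_window_injective x v)
  refine hq.congr fun s => ?_
  simp only [Function.comp]
  rw [norm_mul, Real.mul_rpow (norm_nonneg _) (norm_nonneg _), mul_comm]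

/-- The action of a `d`-site matrix on the sites `x, …, x + d - 1`, as a linear map. -/
def placeLin {N d : ℕ} (x : ℤ) (M : LocalMatrix N d) : Hil N →ₗ[ℂ] Hil N where
  toFun f := ∑ v : Fin d → Fin N,
    (⟨fun s => M (window d x s) v * f (overwrite x v s),
      memℓp_overwrite x v (fun w => M w v) f⟩ : Hil N)
  map_add' f g := by
    rw [← Finset.sum_add_distrib]
    refine Finset.sum_congr rfl fun v _ => ?_
    ext s
    simp only [lp.coeFn_add, Pi.add_apply, mul_add]
  map_smul' c f := by
    rw [RingHom.id_apply, Finset.smul_sum]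
    refine Finset.sum_congr rfl fun v _ => ?_
    ext s
    simp only [lp.coeFn_smul, Pi.smul_apply, smul_eq_mul, mul_left_comm]

theorem placeLin_apply {N d : ℕ} (x : ℤ) (M : LocalMatrix N d) (f : Hil N) (s : Config N) :
    placeLin x M f s = ∑ v : Fin d → Fin N, M (window d x s) v * f (overwrite x v s) := by
  change (⇑(∑ v : Fin d → Fin N, (_ : Hil N))) s = _
  rw [lp.coeFn_sum, Finset.sum_apply]

theorem continuous_coord {N : ℕ} (s : Config N) : Continuous fun f : Hil N => f s := by
  have h : LipschitzWith 1 fun f : Hil N => f s := by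
    refine LipschitzWith.of_dist_le_mul fun f g => ?_
    rw [dist_eq_norm, dist_eq_norm]
    have := lp.norm_apply_le_norm (p := 2) (by norm_num) (f - g) s
    simpa using this
  exact h.continuous

/-- The operator `η_x(M) = ⋯ ⊗ 1 ⊗ M ⊗ 1 ⊗ ⋯`, with the `d`-site matrix `M` acting on the sites
`x, …, x + d - 1`. -/
def place {N d : ℕ} (x : ℤ) (M : LocalMatrix N d) : Op N :=
  ContinuousLinearMap.ofSeqClosedGraph (g := placeLin x M) (by
    intro u f g hu hg
    ext s
    have h1 := ((continuous_coord s).tendsto g).comp hg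
    have h2 : Tendsto (fun n => placeLin x M (u n) s) atTop (𝓝 (placeLin x M f s)) := by
      simp only [placeLin_apply]
      exact tendsto_finsetSum _ fun v _ =>
        (((continuous_coord (overwrite x v s)).tendsto f).comp hu).const_mul _
    exact tendsto_nhds_unique h1 h2)

theorem place_apply {N d : ℕ} (x : ℤ) (M : LocalMatrix N d) (f : Hil N) (s : Config N) :
    place x M f s = ∑ v : Fin d → Fin N, M (window d x s) v * f (overwrite x v s) :=
  placeLin_apply x M f s

/-- The local algebra of the sites `x, …, x + d - 1`. -/
def localAlgebra (N : ℕ) (x : ℤ) (d : ℕ) : Set (Op N) :=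
  Set.range fun M : LocalMatrix N d => place x M

/-- The quasi-local UHF C*-algebra of the chain: the norm closure of the *-algebra of all local
observables. -/
def quasiLocalAlgebra (N : ℕ) : StarSubalgebra ℂ (Op N) :=
  (StarAlgebra.adjoin ℂ (⋃ (x : ℤ) (d : ℕ), localAlgebra N x d)).topologicalClosure

/-- The uniform product measure on configurations. -/
def uniformConfig (N : ℕ) [NeZero N] : Measure (Config N) :=
  Measure.infinitePi fun _ : ℤ => (PMF.uniformOfFintype (Fin N)).toMeasure

open Classical in
/-- The tracial (infinite-temperature) state `ω`: the average of the diagonal matrix elements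
`⟨s, A s⟩` over independent uniformly distributed sites. On a local observable it is the
normalized trace. -/
def tracialState {N : ℕ} [NeZero N] (A : Op N) : ℂ :=
  ∫ s, (A (lp.single 2 s (1 : ℂ))) s ∂(uniformConfig N)

/-- The homogeneous sum `∑_x η_x(M)` over all translates of the `d`-site matrix `M` inside the
interval `[a, b]`. -/
def homogeneousSum {N d : ℕ} (M : LocalMatrix N d) (a b : ℤ) : Op N :=
  ∑ x ∈ Finset.Icc a (b - d + 1), place x M

/-- Heisenberg evolution generated by the Hamiltonian of the finite chain `[a, b]` with
interaction `h`. -/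
def finiteEvolution {N d : ℕ} (h : LocalMatrix N d) (a b : ℤ) (t : ℝ) (A : Op N) : Op N :=
  NormedSpace.exp ((Complex.I * t) • homogeneousSum h a b) * A *
    NormedSpace.exp (-(Complex.I * t) • homogeneousSum h a b)

/-- Heisenberg evolution of the infinite chain: the norm limit of the evolutions of `[a, b]` as
`a → -∞` and `b → ∞`. -/
def evolution {N d : ℕ} (h : LocalMatrix N d) (t : ℝ) (A : Op N) : Op N :=
  limUnder (atBot ×ˢ atTop) fun p : ℤ × ℤ => finiteEvolution h p.1 p.2 t A

/-- `Q n` is almost conserved: its commutator with the Hamiltonian of `[1, n]` is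
`b_1 - b_{n - d_b + 1}` for a fixed local operator `b` on `d_b` sites. -/
def IsAlmostConserved {N d : ℕ} (h : LocalMatrix N d) (Q : ℕ → Op N) : Prop :=
  ∃ (db : ℕ) (b : LocalMatrix N db), ∀ n : ℕ, db ≤ n →
    homogeneousSum h 1 n * Q n - Q n * homogeneousSum h 1 n =
      place 1 b - place ((n : ℤ) - db + 1) b

/-- `Q n` is a translation-invariant sum of pseudo-local densities with exponentially decaying
Hilbert–Schmidt norms. -/
def IsPseudoLocal {N : ℕ} [NeZero N] (Q : ℕ → Op N) : Prop :=
  ∃ (q : ∀ d : ℕ, LocalMatrix N d) (ζ ξ : ℝ), 0 < ζ ∧ 0 < ξ ∧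
    (∀ d, 1 ≤ d → (q d).IsHermitian ∧ tracialState (place 0 (q d)) = 0 ∧
      (tracialState (place 0 (q d) * place 0 (q d))).re ≤ ζ * Real.exp (-ξ * d)) ∧
    ∀ n : ℕ, Q n = ∑ d ∈ Finset.Icc 1 n, homogeneousSum (q d) 1 n

/-- The quotient `(1/n) ω(J_n Q_n)² / ω(Q_n²)`; for self-adjoint `J_n`, `Q_n` both values of the
tracial state are real. -/
def mazurRatio {N d : ℕ} [NeZero N] (j : LocalMatrix N d) (Q : ℕ → Op N) (n : ℕ) : ℝ :=
  1 / n * ((tracialState (homogeneousSum j 1 n * Q n)).re ^ 2 / (tracialState (Q n * Q n)).re)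

end SpinChain

end

open SpinChain

/-!
By Lieb–Robinson bounds the finite-volume dynamics converge on local observables, hence on the
quasi-local algebra, and the correlations `ω(j_x τ_t(j_y))` decay exponentially in `|x - y|`,
uniformly for `t` in a compact interval. By dominated convergence `C(t)` is then the limit of the
autocorrelations per site of `J_n` under the dynamics of the finite chain itself.

There the integral of `C_n(s' - s)` over `[0, T]²` is the squared Hilbert–Schmidt norm of
`n^(-1/2) ∫₀ᵀ τ_s(J_n) ds`, so in the limit the square root of the integral of `C(s' - s)` is
subadditive in `T`, and Fekete's lemma gives a limit of this integral divided by `T²`. A Tauberian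
argument identifies it as the limit of the time averages of `C`.

The overlap of `∫₀ᵀ τ_s(J_n) ds` with `Q_n` is bounded by Cauchy–Schwarz and equals `T ω(J_n Q_n)`
up to correlations of `J_n` with the boundary terms `b_1` and `b_{n - d_b + 1}`. These are bounded
in `n`, hence negligible after division by `√n`, since the Hilbert–Schmidt norm of `Q_n` is bounded
below unless the boundary terms vanish. This is the Mazur bound at a fixed `T`, and `T → ∞` follows.

For a pseudo-local charge, densities that do not overlap are uncorrelated, so all pair correlations
are dominated by a summable function of their ranges and distance, and the limits per site exist.
-/

noncomputable section

namespace SpinChain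

open Classical in
/-- The basis vector of the configuration `s`. -/
def ket {N : ℕ} (s : Config N) : Hil N := lp.single 2 s (1 : ℂ)

theorem ket_apply {N : ℕ} (s s' : Config N) [Decidable (s' = s)] :
    ket s s' = if s' = s then (1 : ℂ) else 0 := by
  classical
  rw [ket, lp.single_apply, Pi.single_apply]
  split_ifs <;> rfl

theorem inner_ket {N : ℕ} (s : Config N) (f : Hil N) : inner ℂ (ket s) f = f s := by
  classical
  rw [ket, lp.inner_single_left, RCLike.inner_apply, map_one, mul_one]

theorem norm_ket {N : ℕ} (s : Config N) : ‖ket s‖ = 1 := by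
  classical
  rw [ket, lp.norm_single (by norm_num), norm_one]

theorem norm_apply_ket_le {N : ℕ} (A : Op N) (s s' : Config N) : ‖A (ket s) s'‖ ≤ ‖A‖ :=
  calc ‖A (ket s) s'‖ ≤ ‖A (ket s)‖ := lp.norm_apply_le_norm (by norm_num) _ s'
    _ ≤ ‖A‖ * ‖ket s‖ := A.le_opNorm _
    _ = ‖A‖ := by rw [norm_ket, mul_one]

section Window

variable {N d d' : ℕ}

theorem overwrite_apply_of_mem (x : ℤ) (v : Fin d → Fin N) (s : Config N) {i : ℤ}
    (hi : 0 ≤ i - x ∧ i - x < d) : overwrite x v s i = v ⟨(i - x).toNat, by omega⟩ := dif_pos hi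

theorem overwrite_apply_of_notMem (x : ℤ) (v : Fin d → Fin N) (s : Config N) {i : ℤ}
    (hi : ¬ (0 ≤ i - x ∧ i - x < d)) : overwrite x v s i = s i := dif_neg hi

theorem window_apply_toNat (x : ℤ) (s : Config N) {i : ℤ} (hi : 0 ≤ i - x ∧ i - x < d) :
    window d x s ⟨(i - x).toNat, by omega⟩ = s i := by
  have : x + (((i - x).toNat : ℕ) : ℤ) = i := by omega
  simp only [window, this]

@[simp] theorem window_overwrite (x : ℤ) (v : Fin d → Fin N) (s : Config N) :
    window d x (overwrite x v s) = v := by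
  funext k
  rw [window, overwrite_apply_of_mem x v s (i := x + (k : ℕ)) (by omega)]
  congr 1
  ext
  simp

@[simp] theorem overwrite_window (x : ℤ) (s : Config N) : overwrite x (window d x s) s = s := by
  funext i
  by_cases hi : 0 ≤ i - x ∧ i - x < d
  · rw [overwrite_apply_of_mem _ _ _ hi, window_apply_toNat _ _ hi]
  · rw [overwrite_apply_of_notMem _ _ _ hi]

@[simp] theorem overwrite_overwrite (x : ℤ) (u v : Fin d → Fin N) (s : Config N) :
    overwrite x u (overwrite x v s) = overwrite x u s := by
  funext i
  by_cases hi : 0 ≤ i - x ∧ i - x < d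
  · simp only [overwrite_apply_of_mem _ _ _ hi]
  · simp only [overwrite_apply_of_notMem _ _ _ hi]

theorem overwrite_eq_iff (x : ℤ) (v : Fin d → Fin N) (s s' : Config N) :
    overwrite x v s = s' ↔ v = window d x s' ∧ overwrite x (window d x s) s' = s := by
  constructor
  · rintro rfl; simp
  · rintro ⟨rfl, h⟩; rw [← h]; simp

/-- The windows `x, …, x + d - 1` and `y, …, y + d' - 1` have no common site, one lying to the left
of the other. -/
def DisjointWindows (x : ℤ) (d : ℕ) (y : ℤ) (d' : ℕ) : Prop := x + d ≤ y ∨ y + d' ≤ x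

theorem DisjointWindows.symm {x y : ℤ} (hxy : DisjointWindows x d y d') :
    DisjointWindows y d' x d := Or.symm hxy

theorem window_overwrite_of_disjoint {x y : ℤ} (hxy : DisjointWindows x d y d')
    (v : Fin d → Fin N) (s : Config N) : window d' y (overwrite x v s) = window d' y s := by
  funext k
  unfold DisjointWindows at hxy
  exact overwrite_apply_of_notMem x v s (by omega)

theorem overwrite_comm_of_disjoint {x y : ℤ} (hxy : DisjointWindows x d y d')
    (v : Fin d → Fin N) (u : Fin d' → Fin N) (s : Config N) :
    overwrite y u (overwrite x v s) = overwrite x v (overwrite y u s) := by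
  unfold DisjointWindows at hxy
  funext i
  by_cases hi : 0 ≤ i - x ∧ i - x < d
  · have hi' : ¬ (0 ≤ i - y ∧ i - y < d') := by omega
    rw [overwrite_apply_of_notMem _ _ _ hi', overwrite_apply_of_mem _ _ _ hi,
      overwrite_apply_of_mem _ _ _ hi]
  · rw [overwrite_apply_of_notMem x _ _ hi]
    by_cases hi' : 0 ≤ i - y ∧ i - y < d'
    · simp only [overwrite_apply_of_mem y _ _ hi']
    · simp only [overwrite_apply_of_notMem y _ _ hi', overwrite_apply_of_notMem x _ _ hi]

theorem overwrite_window_overwrite {x y : ℤ} (hyx : y ≤ x) (hxy : x + d ≤ y + d')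
    (u : Fin d → Fin N) (s : Config N) :
    overwrite y (window d' y (overwrite x u s)) s = overwrite x u s := by
  funext i
  by_cases hi : 0 ≤ i - y ∧ i - y < d'
  · rw [overwrite_apply_of_mem _ _ _ hi, window_apply_toNat _ _ hi]
  · rw [overwrite_apply_of_notMem _ _ _ hi, overwrite_apply_of_notMem _ _ _ (by omega)]

theorem exists_window_of_subwindow {x y : ℤ} (hyx : y ≤ x) (hxy : x + d ≤ y + d') :
    ∃ res : (Fin d' → Fin N) → Fin d → Fin N, ∀ s, res (window d' y s) = window d x s := by
  refine ⟨fun w k => w ⟨(x + (k : ℕ) - y).toNat, by omega⟩, fun s => funext fun k => ?_⟩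
  have : y + (((x + (k : ℕ) - y).toNat : ℕ) : ℤ) = x + (k : ℕ) := by omega
  simp only [window, this]

theorem exists_window_overwrite (x y : ℤ) (u : Fin d → Fin N) :
    ∃ upd : (Fin d' → Fin N) → Fin d' → Fin N,
      ∀ s, upd (window d' y s) = window d' y (overwrite x u s) :=
  ⟨fun w k => if hk : 0 ≤ y + (k : ℕ) - x ∧ y + (k : ℕ) - x < d then
    u ⟨(y + (k : ℕ) - x).toNat, by omega⟩ else w k, fun _ => rfl⟩

end Window

section Place

variable {N d d' : ℕ}

theorem op_ext {A B : Op N} (hAB : ∀ f s, A f s = B f s) : A = B :=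
  ContinuousLinearMap.ext fun f => lp.ext (funext (hAB f))

theorem place_add (x : ℤ) (M M' : LocalMatrix N d) : place x (M + M') = place x M + place x M' := by
  refine op_ext fun f s => ?_
  rw [add_apply, lp.coeFn_add, Pi.add_apply]
  simp only [place_apply, Matrix.add_apply, add_mul, Finset.sum_add_distrib]

theorem place_smul (x : ℤ) (c : ℂ) (M : LocalMatrix N d) : place x (c • M) = c • place x M := by
  refine op_ext fun f s => ?_
  rw [smul_apply, lp.coeFn_smul, Pi.smul_apply]
  simp only [place_apply, Matrix.smul_apply, smul_eq_mul, mul_assoc, Finset.mul_sum]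

theorem place_mul (x : ℤ) (M M' : LocalMatrix N d) : place x (M * M') = place x M * place x M' := by
  refine op_ext fun f s => ?_
  rw [mul_apply_eq_comp]
  simp only [place_apply, Matrix.mul_apply, window_overwrite, overwrite_overwrite, Finset.sum_mul,
    Finset.mul_sum]
  rw [Finset.sum_comm]
  simp only [mul_assoc]

theorem place_one (x : ℤ) : place x (1 : LocalMatrix N d) = 1 := by
  classical
  refine op_ext fun f s => ?_
  simp only [place_apply, Matrix.one_apply, ite_mul, one_mul, zero_mul, Finset.sum_ite_eq,
    Finset.mem_univ, if_true, overwrite_window, one_apply_eq_self]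

theorem place_ket (x : ℤ) (M : LocalMatrix N d) (s : Config N) :
    place x M (ket s) = ∑ v, M v (window d x s) • ket (overwrite x v s) := by
  classical
  refine lp.ext (funext fun s' => ?_)
  rw [place_apply, lp.coeFn_sum, Finset.sum_apply]
  have hcomm (v : Fin d → Fin N) : s' = overwrite x v s ↔
      v = window d x s' ∧ overwrite x (window d x s) s' = s := by rw [eq_comm, overwrite_eq_iff]
  have hcomm' (v : Fin d → Fin N) : overwrite x v s' = s ↔
      v = window d x s ∧ overwrite x (window d x s') s = s' := overwrite_eq_iff x v s' s
  simp only [lp.coeFn_smul, Pi.smul_apply, smul_eq_mul, ket_apply, mul_ite, mul_one, mul_zero,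
    hcomm, hcomm', ite_and, Finset.sum_ite_eq', Finset.mem_univ, if_true]

theorem place_ket_self (x : ℤ) (M : LocalMatrix N d) (s : Config N) :
    place x M (ket s) s = M (window d x s) (window d x s) := by
  classical
  simp only [place_apply, ket_apply, overwrite_eq_iff, overwrite_window, and_true, mul_ite, mul_one,
    mul_zero, Finset.sum_ite_eq', Finset.mem_univ, if_true]

theorem star_place (x : ℤ) (M : LocalMatrix N d) : star (place x M) = place x (star M) := by
  refine op_ext fun f s => ?_
  rw [ContinuousLinearMap.star_eq_adjoint, ← inner_ket, ContinuousLinearMap.adjoint_inner_right,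
    place_ket, sum_inner, place_apply]
  refine Finset.sum_congr rfl fun v _ => ?_
  rw [inner_smul_left, inner_ket]
  rfl

/-- The embedding `M ↦ ⋯ ⊗ 1 ⊗ M ⊗ 1 ⊗ ⋯` of the `d`-site matrices at the site `x`, as a
homomorphism of *-algebras. -/
def placeHom (N d : ℕ) (x : ℤ) : LocalMatrix N d →⋆ₐ[ℂ] Op N where
  __ := AlgHom.ofLinearMap ⟨⟨place x, place_add x⟩, place_smul x⟩ (place_one x) (place_mul x)
  map_star' M := (star_place x M).symm

theorem commute_place_of_disjoint {x y : ℤ} (hxy : DisjointWindows x d y d')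
    (M : LocalMatrix N d) (M' : LocalMatrix N d') : Commute (place x M) (place y M') := by
  refine op_ext fun f s => ?_
  rw [mul_apply_eq_comp, mul_apply_eq_comp]
  simp only [place_apply, Finset.mul_sum, window_overwrite_of_disjoint hxy,
    window_overwrite_of_disjoint hxy.symm, overwrite_comm_of_disjoint hxy, mul_left_comm]
  rw [Finset.sum_comm]

theorem localAlgebra_subset_of_subwindow {x y : ℤ} (hyx : y ≤ x) (hxy : x + d ≤ y + d') :
    localAlgebra N x d ⊆ localAlgebra N y d' := by
  classical
  rintro _ ⟨M, rfl⟩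
  obtain ⟨res, hres⟩ := exists_window_of_subwindow (N := N) hyx hxy
  choose upd hupd using fun u : Fin d → Fin N => exists_window_overwrite (d' := d') x y u
  let M' : LocalMatrix N d' :=
    Matrix.of fun w v => ∑ u, if v = upd u w then M (res w) u else 0
  refine ⟨M', op_ext fun f s => ?_⟩
  simp only [M', place_apply, Matrix.of_apply, Finset.sum_mul, ite_mul, zero_mul]
  rw [Finset.sum_comm]
  simp only [Finset.sum_ite_eq', Finset.mem_univ, if_true, hres, hupd,
    overwrite_window_overwrite hyx hxy]

end Place

section Translation

variable {N d : ℕ}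

/-- The configuration `s` translated by `a` sites to the left. -/
def shiftConfig (a : ℤ) (s : Config N) : Config N := fun i => s (i + a)

theorem window_shiftConfig (a x : ℤ) (s : Config N) :
    window d x (shiftConfig a s) = window d (x + a) s := by
  funext k
  simp only [window, shiftConfig, add_right_comm]

theorem shiftConfig_overwrite (a x : ℤ) (v : Fin d → Fin N) (s : Config N) :
    shiftConfig a (overwrite (x + a) v s) = overwrite x v (shiftConfig a s) := by
  funext i
  simp only [shiftConfig, overwrite, add_sub_add_right_eq_sub]

/-- Translation of configurations as a permutation. -/
def shiftEquiv (N : ℕ) (a : ℤ) : Config N ≃ Config N where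
  toFun := shiftConfig a
  invFun := shiftConfig (-a)
  left_inv s := by funext i; simp [shiftConfig]
  right_inv s := by funext i; simp [shiftConfig]

theorem memℓp_comp_equiv {α β : Type*} (e : α ≃ β) (f : lp (fun _ : β => ℂ) 2) :
    Memℓp (fun s => f (e s)) 2 := by
  have h2 : 0 < (2 : ENNReal).toReal := by norm_num
  exact memℓp_gen (((memℓp_gen_iff h2).1 (lp.memℓp f)).comp_injective e.injective)

/-- The unitary map between `ℓ²` spaces given by relabelling the orthonormal basis. -/
def reindexIsometry {α β : Type*} (e : α ≃ β) :
    lp (fun _ : β => ℂ) 2 ≃ₗᵢ[ℂ] lp (fun _ : α => ℂ) 2 where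
  toFun f := ⟨fun s => f (e s), memℓp_comp_equiv e f⟩
  invFun f := ⟨fun s => f (e.symm s), memℓp_comp_equiv e.symm f⟩
  map_add' _ _ := rfl
  map_smul' _ _ := rfl
  left_inv f := by ext s; simp
  right_inv f := by ext s; simp
  norm_map' f := by
    have h2 : 0 < (2 : ENNReal).toReal := by norm_num
    rw [lp.norm_eq_tsum_rpow h2, lp.norm_eq_tsum_rpow h2]
    exact congrArg (· ^ (1 / (2 : ENNReal).toReal))
      (e.tsum_eq fun s => ‖f s‖ ^ (2 : ENNReal).toReal)

/-- The automorphism `η_a` of the bounded operators: translation by `a` sites, implemented by the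
unitary that translates the configurations. -/
def translateOp (N : ℕ) (a : ℤ) : Op N ≃⋆ₐ[ℂ] Op N :=
  (reindexIsometry (shiftEquiv N a)).conjStarAlgEquiv

theorem translateOp_apply_apply (a : ℤ) (A : Op N) (f : Hil N) (s : Config N) :
    translateOp N a A f s = A ((reindexIsometry (shiftEquiv N a)).symm f) (shiftConfig a s) := rfl

theorem norm_translateOp (a : ℤ) (A : Op N) : ‖translateOp N a A‖ = ‖A‖ :=
  NonUnitalStarAlgHom.norm_map (translateOp N a : Op N →⋆ₐ[ℂ] Op N) (translateOp N a).injective A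

theorem translateOp_place (a x : ℤ) (M : LocalMatrix N d) :
    translateOp N a (place x M) = place (x + a) M := by
  refine op_ext fun f s => ?_
  rw [translateOp_apply_apply, place_apply, place_apply, window_shiftConfig]
  refine Finset.sum_congr rfl fun v _ => ?_
  rw [← shiftConfig_overwrite]
  exact congrArg (fun s' => M (window d (x + a) s) v * f s')
    ((shiftEquiv N a).symm_apply_apply (overwrite (x + a) v s))

theorem norm_place (x : ℤ) (M : LocalMatrix N d) : ‖place x M‖ = ‖place 0 M‖ := by
  rw [← norm_translateOp x (place 0 M), translateOp_place, zero_add]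

end Translation

section TracialState

variable {A : Type*} [CStarAlgebra A]

/-- A tracial state on a C*-algebra, as a property of a bounded functional. Positivity is stated
through the values on `star a * a`, so that no order on the algebra is needed. -/
structure IsTracialState (φ : A →L[ℂ] ℂ) : Prop where
  mul_comm : ∀ a b, φ (a * b) = φ (b * a)
  map_star : ∀ a, φ (star a) = starRingEnd ℂ (φ a)
  nonneg : ∀ a, 0 ≤ (φ (star a * a)).re
  norm_le : ∀ a, ‖φ a‖ ≤ ‖a‖

/-- The Hilbert–Schmidt seminorm `φ(a* a)^(1/2)` of a tracial state `φ`. -/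
def hsNorm (φ : A →L[ℂ] ℂ) (a : A) : ℝ := √(φ (star a * a)).re

theorem hsNorm_nonneg (φ : A →L[ℂ] ℂ) (a : A) : 0 ≤ hsNorm φ a := Real.sqrt_nonneg _

namespace IsTracialState

variable {φ : A →L[ℂ] ℂ} (hφ : IsTracialState φ)
include hφ

theorem hsNorm_sq (a : A) : hsNorm φ a ^ 2 = (φ (star a * a)).re := Real.sq_sqrt (hφ.nonneg a)

theorem norm_apply_star_mul_le (a b : A) : ‖φ (star a * b)‖ ≤ hsNorm φ a * hsNorm φ b := by
  let core : PreInnerProductSpace.Core ℂ A :=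
    { inner a b := φ (star a * b)
      conj_inner_symm a b := by rw [← hφ.map_star, star_mul, star_star]
      re_inner_nonneg := hφ.nonneg
      add_left a b c := by simp only [star_add, add_mul, map_add]
      smul_left a b c := by simp only [star_smul, smul_mul_assoc, map_smul, smul_eq_mul,
        RCLike.star_def] }
  exact InnerProductSpace.Core.norm_inner_le_norm (c := core) a b

theorem hsNorm_le_norm (a : A) : hsNorm φ a ≤ ‖a‖ := by
  refine Real.sqrt_le_iff.2 ⟨norm_nonneg _, ?_⟩
  calc (φ (star a * a)).re ≤ ‖φ (star a * a)‖ := Complex.re_le_norm _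
    _ ≤ ‖star a * a‖ := hφ.norm_le _
    _ = ‖a‖ ^ 2 := by rw [CStarRing.norm_star_mul_self, sq]

theorem hsNorm_add_le (a b : A) : hsNorm φ (a + b) ≤ hsNorm φ a + hsNorm φ b := by
  refine le_of_abs_le <|
    abs_le_of_sq_le_sq ?_ (add_nonneg (hsNorm_nonneg φ a) (hsNorm_nonneg φ b))
  have hab := (Complex.re_le_norm _).trans (hφ.norm_apply_star_mul_le a b)
  have hba := (Complex.re_le_norm _).trans (hφ.norm_apply_star_mul_le b a)
  rw [hφ.hsNorm_sq, add_sq, hφ.hsNorm_sq, hφ.hsNorm_sq]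
  simp only [star_add, mul_add, add_mul, map_add, Complex.add_re]
  linarith

theorem im_apply_eq_zero {a : A} (ha : IsSelfAdjoint a) : (φ a).im = 0 := by
  rw [← Complex.conj_eq_iff_im, ← hφ.map_star, ha.star_eq]

theorem im_apply_mul_eq_zero {a b : A} (ha : IsSelfAdjoint a) (hb : IsSelfAdjoint b) :
    (φ (a * b)).im = 0 := by
  rw [← Complex.conj_eq_iff_im, ← hφ.map_star, star_mul, ha.star_eq, hb.star_eq, hφ.mul_comm]

theorem norm_apply_mul_le (a b : A) : ‖φ (a * b)‖ ≤ hsNorm φ a * hsNorm φ b := by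
  have hstar : hsNorm φ (star a) = hsNorm φ a := by rw [hsNorm, hsNorm, star_star, hφ.mul_comm]
  simpa only [star_star, hstar] using hφ.norm_apply_star_mul_le (star a) b

theorem apply_lie_mul (h a b : A) : φ (⁅h, a⁆ * b) = -φ (a * ⁅h, b⁆) := by
  rw [Ring.lie_def, Ring.lie_def, sub_mul, mul_sub, map_sub, map_sub, mul_assoc h, hφ.mul_comm h,
    mul_assoc, mul_assoc, neg_sub]

end IsTracialState

end TracialState

section QuasiLocal

variable {N d d' : ℕ}

theorem exists_common_window (x y : ℤ) (M : LocalMatrix N d) (M' : LocalMatrix N d') :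
    ∃ (z : ℤ) (e : ℕ) (L L' : LocalMatrix N e),
      place z L = place x M ∧ place z L' = place y M' := by
  let z := min x y
  let e := (max (x + d) (y + d') - z).toNat
  obtain ⟨L, hL⟩ := localAlgebra_subset_of_subwindow (d' := e) (y := z) (by omega) (by omega)
    (Set.mem_range_self M : place x M ∈ localAlgebra N x d)
  obtain ⟨L', hL'⟩ := localAlgebra_subset_of_subwindow (d' := e) (y := z) (by omega) (by omega)
    (Set.mem_range_self M' : place y M' ∈ localAlgebra N y d')
  exact ⟨z, e, L, L', hL, hL'⟩

/-- The *-algebra of all local observables. -/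
def localSubalgebra (N : ℕ) : StarSubalgebra ℂ (Op N) where
  carrier := {A | ∃ x d, A ∈ localAlgebra N x d}
  mul_mem' := by
    rintro _ _ ⟨x, d, M, rfl⟩ ⟨y, d', M', rfl⟩
    obtain ⟨z, e, L, L', hL, hL'⟩ := exists_common_window x y M M'
    exact ⟨z, e, L * L', by simp only [place_mul, hL, hL']⟩
  add_mem' := by
    rintro _ _ ⟨x, d, M, rfl⟩ ⟨y, d', M', rfl⟩
    obtain ⟨z, e, L, L', hL, hL'⟩ := exists_common_window x y M M'
    exact ⟨z, e, L + L', by simp only [place_add, hL, hL']⟩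
  algebraMap_mem' c := ⟨0, 0, algebraMap ℂ _ c, (placeHom N 0 0).commutes c⟩
  star_mem' := by
    rintro _ ⟨x, d, M, rfl⟩
    exact ⟨x, d, star M, (star_place x M).symm⟩

theorem quasiLocalAlgebra_eq : quasiLocalAlgebra N = (localSubalgebra N).topologicalClosure := by
  rw [quasiLocalAlgebra]
  congr 1
  refine le_antisymm (StarAlgebra.adjoin_le ?_) ?_
  · simp only [Set.iUnion_subset_iff]
    exact fun x d A hA => ⟨x, d, hA⟩
  · rintro A ⟨x, d, hA⟩
    exact StarAlgebra.subset_adjoin ℂ _ (Set.mem_iUnion₂.2 ⟨x, d, hA⟩)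

theorem place_mem_quasiLocalAlgebra (x : ℤ) (M : LocalMatrix N d) :
    place x M ∈ quasiLocalAlgebra N := by
  rw [quasiLocalAlgebra_eq]
  exact StarSubalgebra.le_topologicalClosure _ ⟨x, d, M, rfl⟩

instance isClosed_quasiLocalAlgebra : IsClosed (quasiLocalAlgebra N : Set (Op N)) :=
  StarSubalgebra.isClosed_topologicalClosure _

/-- The quasi-local algebra as a C*-algebra in its own right. -/
def QuasiLocal (N : ℕ) : Type := quasiLocalAlgebra N

instance : CStarAlgebra (QuasiLocal N) := inferInstanceAs (CStarAlgebra (quasiLocalAlgebra N))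

instance : CoeOut (QuasiLocal N) (Op N) := ⟨Subtype.val⟩

/-- The local observable `η_x(M)` as an element of the quasi-local algebra. -/
def observable (x : ℤ) : LocalMatrix N d →⋆ₐ[ℂ] QuasiLocal N :=
  (placeHom N d x).codRestrict (quasiLocalAlgebra N) (place_mem_quasiLocalAlgebra x)

@[simp] theorem coe_observable (x : ℤ) (M : LocalMatrix N d) :
    (observable x M : Op N) = place x M := rfl

theorem exists_observable_norm_sub_lt (A : QuasiLocal N) {ε : ℝ} (hε : 0 < ε) :
    ∃ (x : ℤ) (d : ℕ) (M : LocalMatrix N d), ‖A - observable x M‖ < ε := by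
  have hA : (A : Op N) ∈ closure (localSubalgebra N : Set (Op N)) := by
    rw [← StarSubalgebra.topologicalClosure_coe, ← quasiLocalAlgebra_eq]
    exact A.2
  obtain ⟨_, ⟨x, d, M, rfl⟩, hM⟩ := Metric.mem_closure_iff.1 hA ε hε
  exact ⟨x, d, M, by rwa [dist_eq_norm] at hM⟩

theorem quasiLocal_induction {p : QuasiLocal N → Prop} (hp : IsClosed {A | p A})
    (hloc : ∀ (x : ℤ) (d : ℕ) (M : LocalMatrix N d), p (observable x M)) (A : QuasiLocal N) :
    p A := by
  refine hp.closure_subset (Metric.mem_closure_iff.2 fun ε hε => ?_)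
  obtain ⟨x, d, M, hM⟩ := exists_observable_norm_sub_lt A hε
  exact ⟨observable x M, hloc x d M, by rwa [dist_eq_norm]⟩

theorem norm_observable (x : ℤ) (M : LocalMatrix N d) : ‖observable x M‖ = ‖observable 0 M‖ :=
  norm_place x M

theorem commute_observable_of_disjoint {x y : ℤ} (hxy : DisjointWindows x d y d')
    (M : LocalMatrix N d) (M' : LocalMatrix N d') :
    Commute (observable x M) (observable y M') :=
  Subtype.ext (commute_place_of_disjoint hxy M M')

theorem isSelfAdjoint_observable (x : ℤ) {M : LocalMatrix N d} (hM : M.IsHermitian) :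
    IsSelfAdjoint (observable x M) :=
  IsSelfAdjoint.map hM (observable x)

/-- The automorphism `η_a` of the quasi-local algebra. -/
def translate (a : ℤ) : QuasiLocal N →⋆ₐ[ℂ] QuasiLocal N :=
  ((translateOp N a : Op N →⋆ₐ[ℂ] Op N).comp (quasiLocalAlgebra N).subtype).codRestrict
    (quasiLocalAlgebra N) (quasiLocal_induction
      ((isClosed_quasiLocalAlgebra (N := N)).preimage (by
        refine Continuous.comp (g := translateOp N a) ?_ continuous_subtype_val
        exact (AddMonoidHomClass.isometry_of_norm _ (norm_translateOp a)).continuous))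
      fun x d M => by
        change translateOp N a (place x M) ∈ _
        rw [translateOp_place]
        exact place_mem_quasiLocalAlgebra _ M)

theorem translate_observable (a x : ℤ) (M : LocalMatrix N d) :
    translate a (observable x M) = observable (x + a) M :=
  Subtype.ext (translateOp_place a x M)

theorem norm_translate (a : ℤ) (A : QuasiLocal N) : ‖translate a A‖ = ‖A‖ :=
  norm_translateOp a (A : Op N)

theorem continuous_translate (a : ℤ) : Continuous (translate a : QuasiLocal N → QuasiLocal N) :=
  (AddMonoidHomClass.isometry_of_norm _ (norm_translate a)).continuous

end QuasiLocal

section Trace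

variable {N d d' : ℕ}

theorem measurable_window (x : ℤ) : Measurable (window d x : Config N → Fin d → Fin N) :=
  measurable_pi_lambda _ fun _ => measurable_pi_apply _

theorem measurable_place_ket_self (x : ℤ) (M : LocalMatrix N d) :
    Measurable fun s : Config N => place x M (ket s) s := by
  simp only [place_ket_self]
  exact (measurable_of_countable fun w => M w w).comp (measurable_window x)

theorem place_mul_place_ket_self {x y : ℤ} (hxy : DisjointWindows x d y d')
    (M : LocalMatrix N d) (M' : LocalMatrix N d') (s : Config N) :
    (place x M * place y M') (ket s) s = place x M (ket s) s * place y M' (ket s) s := by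
  classical
  rw [mul_apply_eq_comp, place_apply, Finset.sum_eq_single (window d x s)]
  · rw [overwrite_window, place_ket_self x]
  · intro v _ hv
    simp only [place_apply, ket_apply]
    rw [Finset.sum_eq_zero, mul_zero]
    intro u _
    rw [if_neg, mul_zero]
    intro hs
    apply hv
    rw [← hs, window_overwrite_of_disjoint hxy.symm, window_overwrite]
  · simp

variable [NeZero N]

theorem tracialState_eq (A : Op N) : tracialState A = ∫ s, A (ket s) s ∂(uniformConfig N) := rfl

instance : IsProbabilityMeasure (uniformConfig N) := by
  unfold uniformConfig; infer_instance

theorem integrable_diagonal (A : QuasiLocal N) :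
    Integrable (fun s => (A : Op N) (ket s) s) (uniformConfig N) := by
  refine Integrable.of_bound ?_ ‖A‖ (ae_of_all _ fun s => norm_apply_ket_le (A : Op N) s s)
  choose x d M hM using fun n : ℕ =>
    exists_observable_norm_sub_lt A (Nat.one_div_pos_of_nat (α := ℝ) (n := n))
  refine (measurable_of_tendsto_metrizable (fun n => measurable_place_ket_self (x n) (M n))
    (tendsto_pi_nhds.2 fun s => ?_)).aestronglyMeasurable
  rw [tendsto_iff_norm_sub_tendsto_zero]
  refine squeeze_zero (fun _ => norm_nonneg _) (fun n => ?_) tendsto_one_div_add_atTop_nhds_zero_nat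
  rw [norm_sub_rev]
  exact (norm_apply_ket_le ((A : Op N) - place (x n) (M n)) s s).trans (hM n).le

theorem tracialState_place (x : ℤ) (M : LocalMatrix N d) :
    tracialState (place x M) = ((N : ℂ) ^ d)⁻¹ * M.trace := by
  have hmap : (uniformConfig N).map (window d x) =
      Measure.infinitePi fun _ : Fin d => (PMF.uniformOfFintype (Fin N)).toMeasure :=
    Measure.map_infinitePi_infinitePi_of_inj (f := fun k : Fin d => x + ((k : ℕ) : ℤ))
      (fun k l hkl => by ext; simpa using hkl)
  rw [tracialState_eq]
  simp only [place_ket_self]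
  rw [← integral_map (φ := window d x) (f := fun w => M w w) (measurable_window x).aemeasurable
    (measurable_of_countable _).aestronglyMeasurable, hmap, integral_fintype Integrable.of_finite,
    Matrix.trace, Finset.mul_sum]
  refine Finset.sum_congr rfl fun w _ => ?_
  rw [Measure.real, Measure.infinitePi_singleton_of_fintype]
  simp [Matrix.diag]

theorem tracialState_star_mul_self (A : Op N) :
    tracialState (star A * A) = ((∫ s, ‖A (ket s)‖ ^ 2 ∂(uniformConfig N) : ℝ) : ℂ) := by
  rw [tracialState_eq, ← integral_complex_ofReal]
  refine integral_congr_ae (ae_of_all _ fun s => ?_)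
  simp only
  rw [mul_apply_eq_comp, ← inner_ket, ContinuousLinearMap.star_eq_adjoint,
    ContinuousLinearMap.adjoint_inner_right, inner_self_eq_norm_sq_to_K]
  simp

theorem tracialState_star (A : Op N) :
    tracialState (star A) = starRingEnd ℂ (tracialState A) := by
  rw [tracialState_eq, tracialState_eq, ← integral_conj]
  refine integral_congr_ae (ae_of_all _ fun s => ?_)
  simp only
  rw [← inner_ket, ← inner_ket, ContinuousLinearMap.star_eq_adjoint,
    ContinuousLinearMap.adjoint_inner_right, inner_conj_symm]

theorem norm_tracialState_le (A : Op N) : ‖tracialState A‖ ≤ ‖A‖ := by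
  rw [tracialState_eq]
  refine (norm_integral_le_of_norm_le_const
    (ae_of_all _ fun s => norm_apply_ket_le A s s)).trans_eq ?_
  rw [probReal_univ, mul_one]

/-- The tracial state as a bounded functional on the quasi-local algebra. It is additive only
there: the diagonal matrix elements of a general bounded operator need not be measurable. -/
def trace (N : ℕ) [NeZero N] : QuasiLocal N →L[ℂ] ℂ :=
  LinearMap.mkContinuous
    { toFun := fun A => tracialState (A : Op N)
      map_add' := fun A B => integral_add (integrable_diagonal A) (integrable_diagonal B)
      map_smul' := fun c _ => integral_const_mul c _ } 1
    fun A => (norm_tracialState_le (A : Op N)).trans_eq (one_mul _).symm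

theorem trace_apply (A : QuasiLocal N) : trace N A = tracialState (A : Op N) := rfl

theorem trace_observable (x : ℤ) (M : LocalMatrix N d) :
    trace N (observable x M) = ((N : ℂ) ^ d)⁻¹ * M.trace := tracialState_place x M

theorem trace_mul_comm (A B : QuasiLocal N) : trace N (A * B) = trace N (B * A) := by
  refine quasiLocal_induction (p := fun A => trace N (A * B) = trace N (B * A))
    (isClosed_eq (by fun_prop) (by fun_prop)) (fun x d M => ?_) A
  refine quasiLocal_induction
    (p := fun B => trace N (observable x M * B) = trace N (B * observable x M))
    (isClosed_eq (by fun_prop) (by fun_prop)) (fun y d' M' => ?_) B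
  obtain ⟨z, e, L, L', hL, hL'⟩ := exists_common_window x y M M'
  have hL : observable z L = observable x M := Subtype.ext hL
  have hL' : observable z L' = observable y M' := Subtype.ext hL'
  rw [← hL, ← hL', ← map_mul, ← map_mul, trace_observable, trace_observable,
    Matrix.trace_mul_comm]

theorem isTracialState_trace : IsTracialState (trace N) where
  mul_comm := trace_mul_comm
  map_star A := tracialState_star (A : Op N)
  nonneg A := by
    rw [trace_apply, show ((star A * A : QuasiLocal N) : Op N) = star (A : Op N) * A from rfl,
      tracialState_star_mul_self, Complex.ofReal_re]
    exact integral_nonneg fun _ => by positivity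
  norm_le A := norm_tracialState_le (A : Op N)

theorem trace_translate (a : ℤ) (A : QuasiLocal N) : trace N (translate a A) = trace N A := by
  have := continuous_translate (N := N) a
  refine quasiLocal_induction (p := fun A => trace N (translate a A) = trace N A)
    (isClosed_eq (by fun_prop) (by fun_prop)) (fun x d M => ?_) A
  rw [translate_observable, trace_observable, trace_observable]

theorem indepFun_window {x y : ℤ} (hxy : DisjointWindows x d y d') :
    ProbabilityTheory.IndepFun (window d x : Config N → _) (window d' y) (uniformConfig N) := by
  have hdisj : Disjoint (Finset.Ico x (x + d)) (Finset.Ico y (y + d')) := by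
    rw [Finset.disjoint_left]
    intro i hi hi'
    simp only [Finset.mem_Ico] at hi hi'
    rcases hxy with h | h <;> omega
  have hindep := (ProbabilityTheory.iIndepFun_infinitePi
    (P := fun _ : ℤ => (PMF.uniformOfFintype (Fin N)).toMeasure) (X := fun _ a => a)
    (fun _ => measurable_id)).indepFun_finset _ _ hdisj fun i => measurable_pi_apply i
  exact hindep.comp
    (φ := fun w k => w ⟨x + ((k : Fin d) : ℕ), by have := k.2; simp⟩)
    (ψ := fun w k => w ⟨y + ((k : Fin d') : ℕ), by have := k.2; simp⟩)
    (measurable_of_countable _) (measurable_of_countable _)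

theorem trace_mul_observable_of_disjoint {x y : ℤ} (hxy : DisjointWindows x d y d')
    (M : LocalMatrix N d) (M' : LocalMatrix N d') :
    trace N (observable x M * observable y M') =
      trace N (observable x M) * trace N (observable y M') := by
  have hindep := (indepFun_window (N := N) hxy).comp
    (measurable_of_countable fun w => M w w) (measurable_of_countable fun w => M' w w)
  have hmul := hindep.integral_fun_mul_eq_mul_integral
    ((measurable_of_countable fun w => M w w).comp (measurable_window x)).aestronglyMeasurable
    ((measurable_of_countable fun w => M' w w).comp (measurable_window y)).aestronglyMeasurable
  have hcoe : ((observable x M * observable y M' : QuasiLocal N) : Op N) =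
      place x M * place y M' := rfl
  simp only [trace_apply, tracialState_eq, hcoe, coe_observable, place_mul_place_ket_self hxy,
    place_ket_self]
  exact hmul

end Trace

section Heisenberg

variable {A : Type*} [CStarAlgebra A]

/-- Heisenberg evolution `a ↦ e^{itH} a e^{-itH}` generated by `H`. -/
def heisenberg (H : selfAdjoint A) (t : ℝ) : A ≃⋆ₐ[ℂ] A :=
  Unitary.conjStarAlgAut ℂ A (selfAdjoint.expUnitary (t • H))

theorem heisenberg_apply (H : selfAdjoint A) (t : ℝ) (a : A) :
    heisenberg H t a = NormedSpace.exp (t • Complex.I • (H : A)) * a *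
      NormedSpace.exp (-(t • Complex.I • (H : A))) := by
  have hstar : star (selfAdjoint.expUnitary (t • H)) = selfAdjoint.expUnitary (-(t • H)) := by
    have h := (Commute.refl ((t • H : selfAdjoint A) : A)).neg_right.expUnitary_add
      (a := t • H) (b := -(t • H))
    rw [add_neg_cancel, selfAdjoint.expUnitary_zero] at h
    rw [← mul_one (star _), h, ← mul_assoc, Unitary.star_mul_self, one_mul]
  rw [heisenberg, Unitary.conjStarAlgAut_apply, ← Unitary.coe_star, hstar,
    selfAdjoint.expUnitary_coe, selfAdjoint.expUnitary_coe, AddSubgroup.coe_neg,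
    selfAdjoint.val_smul, smul_neg, smul_comm]

@[simp] theorem heisenberg_zero_time (H : selfAdjoint A) (a : A) : heisenberg H 0 a = a := by
  simp [heisenberg]

theorem heisenberg_add (H : selfAdjoint A) (s t : ℝ) (a : A) :
    heisenberg H (s + t) a = heisenberg H s (heisenberg H t a) := by
  have hcomm : Commute ((s • H : selfAdjoint A) : A) ((t • H : selfAdjoint A) : A) :=
    ((Commute.refl (H : A)).smul_left s).smul_right t
  rw [heisenberg, add_smul, hcomm.expUnitary_add, Unitary.conjStarAlgAut_mul_apply, heisenberg,
    heisenberg]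

theorem heisenberg_neg_heisenberg (H : selfAdjoint A) (t : ℝ) (a : A) :
    heisenberg H (-t) (heisenberg H t a) = a := by
  rw [← heisenberg_add, neg_add_cancel, heisenberg_zero_time]

theorem heisenberg_neg_left (H : selfAdjoint A) (t : ℝ) :
    heisenberg (-H) t = heisenberg H (-t) := by
  rw [heisenberg, heisenberg, smul_neg, neg_smul]

theorem continuous_heisenberg (H : selfAdjoint A) (t : ℝ) : Continuous (heisenberg H t) :=
  (StarAlgEquiv.isometry _).continuous

/-- Heisenberg evolution as a continuous linear map. -/
def heisenbergCLM (H : selfAdjoint A) (t : ℝ) : A →L[ℂ] A :=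
  ⟨(heisenberg H t : A →ₗ[ℂ] A), continuous_heisenberg H t⟩

theorem heisenbergCLM_apply (H : selfAdjoint A) (t : ℝ) (a : A) :
    heisenbergCLM H t a = heisenberg H t a := rfl

theorem commute_heisenberg {H : selfAdjoint A} {a b : A} (hH : Commute b (H : A))
    (ha : Commute b a) (t : ℝ) : Commute b (heisenberg H t a) := by
  let +nondep : NormedAlgebra ℚ A := .restrictScalars ℚ ℂ A
  have hX : Commute b (t • Complex.I • (H : A)) := (hH.smul_right _).smul_right _
  rw [heisenberg_apply]
  exact (hX.exp_right.mul_right ha).mul_right hX.neg_right.exp_right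

theorem heisenberg_mem {S : StarSubalgebra ℂ A} (hS : IsClosed (S : Set A)) {H : selfAdjoint A}
    {a : A} (hH : (H : A) ∈ S) (ha : a ∈ S) (t : ℝ) : heisenberg H t a ∈ S := by
  let +nondep : NormedAlgebra ℚ A := .restrictScalars ℚ ℂ A
  have hX : t • Complex.I • (H : A) ∈ S := by
    rw [← Complex.coe_smul t]
    exact SMulMemClass.smul_mem _ (SMulMemClass.smul_mem _ hH)
  rw [heisenberg_apply]
  exact mul_mem (mul_mem (NormedSpace.exp_mem (R := ℂ) hS hX) ha)
    (NormedSpace.exp_mem (R := ℂ) hS (neg_mem hX))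

theorem hasDerivAt_heisenberg_neg_heisenberg_zero (H H' : selfAdjoint A) (a : A) :
    HasDerivAt (fun s => heisenberg H (-s) (heisenberg H' s a))
      (Complex.I • ⁅(H' - H : A), a⁆) 0 := by
  have hexp (x : A) : HasDerivAt (fun s : ℝ => NormedSpace.exp (s • x)) x 0 := by
    simpa using hasDerivAt_exp_smul_const (𝕂 := ℝ) x 0
  let X : A := Complex.I • (H : A)
  let X' : A := Complex.I • (H' : A)
  have hderiv := ((hexp (-X)).mul (((hexp X').mul_const a).mul (hexp (-X')))).mul (hexp X)
  refine (hderiv.congr_of_eventuallyEq (.of_eq ?_)).congr_deriv ?_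
  · funext s
    simp [heisenberg_apply, X, X']
  · simp only [zero_smul, NormedSpace.exp_zero, Pi.mul_apply, one_mul, mul_one, Ring.lie_def,
      X, X', smul_sub, sub_mul, mul_sub, smul_mul_assoc, mul_smul_comm, mul_neg, neg_mul]
    abel

theorem hasDerivAt_heisenberg_neg_heisenberg (H H' : selfAdjoint A) (a : A) (s : ℝ) :
    HasDerivAt (fun u => heisenberg H (-u) (heisenberg H' u a))
      (heisenberg H (-s) (Complex.I • ⁅(H' - H : A), heisenberg H' s a⁆)) s := by
  have h := hasDerivAt_heisenberg_neg_heisenberg_zero H H' (heisenberg H' s a)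
  rw [← sub_self s] at h
  refine (((heisenbergCLM H (-s)).restrictScalars ℝ).hasFDerivAt.comp_hasDerivAt s
    (h.comp_sub_const s s)).congr_of_eventuallyEq (.of_eq ?_)
  funext u
  change _ = heisenberg H (-s) (heisenberg H (-(u - s)) (heisenberg H' (u - s) _))
  rw [← heisenberg_add, ← heisenberg_add]
  ring_nf

theorem hasDerivAt_heisenberg (H : selfAdjoint A) (a : A) (t : ℝ) :
    HasDerivAt (fun s => heisenberg H s a) (Complex.I • ⁅(H : A), heisenberg H t a⁆) t := by
  have hzero (s : ℝ) (b : A) : heisenberg 0 s b = b := by simp [heisenberg]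
  simpa only [hzero, ZeroMemClass.coe_zero, sub_zero] using
    hasDerivAt_heisenberg_neg_heisenberg 0 H a t

theorem continuous_heisenberg_time (H : selfAdjoint A) (a : A) :
    Continuous fun t => heisenberg H t a :=
  continuous_iff_continuousAt.2 fun t => (hasDerivAt_heisenberg H a t).continuousAt

theorem norm_heisenberg_sub_le_of_nonneg {H H' : selfAdjoint A} {a : A} (c : ℝ) (k : ℕ) {t : ℝ}
    (ht : 0 ≤ t)
    (hc : ∀ u ∈ Set.Ico 0 t, ‖⁅(H' - H : A), heisenberg H' u a⁆‖ ≤ c * u ^ k) :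
    ‖heisenberg H t a - heisenberg H' t a‖ ≤ c * t ^ (k + 1) / (k + 1) := by
  let g (s : ℝ) : A := heisenberg H (-s) (heisenberg H' s a)
  have hg := hasDerivAt_heisenberg_neg_heisenberg H H' a
  have hB (s : ℝ) : HasDerivAt (fun u : ℝ => c * u ^ (k + 1) / (k + 1)) (c * s ^ k) s := by
    refine (((hasDerivAt_pow (k + 1) s).const_mul c).div_const ((k : ℝ) + 1)).congr_deriv ?_
    push_cast
    field_simp
  calc ‖heisenberg H t a - heisenberg H' t a‖
      = ‖g t - g 0‖ := by
        rw [← StarAlgEquiv.norm_map (heisenberg H (-t)), map_sub, heisenberg_neg_heisenberg,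
          norm_sub_rev]
        simp [g]
    _ ≤ c * t ^ (k + 1) / (k + 1) :=
        image_norm_le_of_norm_deriv_right_le_deriv_boundary (f := fun s => g s - g 0) (a := 0)
          (fun s _ => ((hg s).sub_const _).continuousAt.continuousWithinAt)
          (fun s _ => ((hg s).sub_const _).hasDerivWithinAt) (by simp) hB
          (fun s hs => by
            rw [StarAlgEquiv.norm_map, norm_smul, Complex.norm_I, one_mul]
            exact hc s hs) ⟨ht, le_rfl⟩

theorem norm_heisenberg_sub_le {H H' : selfAdjoint A} {a : A} (c : ℝ) (k : ℕ) (t : ℝ)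
    (hc : ∀ u, |u| ≤ |t| → ‖⁅(H' - H : A), heisenberg H' u a⁆‖ ≤ c * |u| ^ k) :
    ‖heisenberg H t a - heisenberg H' t a‖ ≤ c * |t| ^ (k + 1) / (k + 1) := by
  rcases le_total 0 t with ht | ht
  · rw [abs_of_nonneg ht] at hc ⊢
    refine norm_heisenberg_sub_le_of_nonneg c k ht fun u hu => ?_
    simpa only [abs_of_nonneg hu.1] using hc u ((abs_of_nonneg hu.1).trans_le hu.2.le)
  · rw [abs_of_nonpos ht] at hc ⊢
    have hneg (b : A) : ⁅((-H' : selfAdjoint A) - (-H : selfAdjoint A) : A), b⁆ =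
        -⁅(H' - H : A), b⁆ := by
      simp only [AddSubgroup.coe_neg, Ring.lie_def]
      noncomm_ring
    have h := norm_heisenberg_sub_le_of_nonneg (H := -H) (H' := -H') (a := a) c k
      (neg_nonneg.2 ht) fun u hu => by
        have habs : |-u| = u := by rw [abs_neg, abs_of_nonneg hu.1]
        rw [hneg, norm_neg, heisenberg_neg_left]
        simpa only [habs] using hc (-u) (habs.trans_le hu.2.le)
    rwa [heisenberg_neg_left, heisenberg_neg_left, neg_neg] at h

theorem norm_lie_le (a b : A) : ‖⁅a, b⁆‖ ≤ 2 * ‖a‖ * ‖b‖ :=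
  calc ‖⁅a, b⁆‖ ≤ ‖a * b‖ + ‖b * a‖ := norm_sub_le _ _
    _ ≤ ‖a‖ * ‖b‖ + ‖b‖ * ‖a‖ := add_le_add (norm_mul_le _ _) (norm_mul_le _ _)
    _ = 2 * ‖a‖ * ‖b‖ := by ring

/-- The integral of the evolved observable `a` over the times from `0` to `T`. -/
def timeIntegral (H : selfAdjoint A) (a : A) (T : ℝ) : A := ∫ s in (0 : ℝ)..T, heisenberg H s a

theorem map_timeIntegral {F : Type*} [NormedAddCommGroup F] [NormedSpace ℂ F] [CompleteSpace F]
    (L : A →L[ℂ] F) (H : selfAdjoint A) (a : A) (T : ℝ) :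
    L (timeIntegral H a T) = ∫ s in (0 : ℝ)..T, L (heisenberg H s a) :=
  (L.intervalIntegral_comp_comm ((continuous_heisenberg_time H a).intervalIntegrable 0 T)).symm

theorem isSelfAdjoint_timeIntegral (H : selfAdjoint A) {a : A} (ha : IsSelfAdjoint a) (T : ℝ) :
    IsSelfAdjoint (timeIntegral H a T) := by
  have hstar := ((starL' ℝ : A ≃L[ℝ] A) : A →L[ℝ] A).intervalIntegral_comp_comm
    ((continuous_heisenberg_time H a).intervalIntegrable (μ := volume) 0 T)
  rw [IsSelfAdjoint, timeIntegral]
  refine hstar.symm.trans (intervalIntegral.integral_congr fun s _ => ?_)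
  exact (ha.map (heisenberg H s)).star_eq

theorem timeIntegral_add (H : selfAdjoint A) (a : A) (S T : ℝ) :
    timeIntegral H a (S + T) = timeIntegral H a S + heisenberg H S (timeIntegral H a T) := by
  have hcont := continuous_heisenberg_time H a
  rw [← heisenbergCLM_apply, map_timeIntegral]
  simp only [heisenbergCLM_apply, ← heisenberg_add]
  rw [intervalIntegral.integral_comp_add_left (fun s => heisenberg H s a) S, add_zero,
    timeIntegral, timeIntegral, intervalIntegral.integral_add_adjacent_intervals
      (hcont.intervalIntegrable _ _) (hcont.intervalIntegrable _ _)]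

end Heisenberg

section LiebRobinson

theorem pow_div_factorial_le_exp_mul_exp {c : ℝ} (hc : 0 ≤ c) (k : ℕ) (s : ℝ) :
    c ^ k / k.factorial ≤ Real.exp (c * Real.exp s) * Real.exp (-(k * s)) := by
  rw [Real.exp_neg, Real.exp_nat_mul, ← div_eq_mul_inv, le_div_iff₀ (by positivity),
    div_mul_eq_mul_div, ← mul_pow]
  exact Real.pow_div_factorial_le_exp _ (by positivity) k

variable {A : Type*} [CStarAlgebra A] {Φ : ℤ → selfAdjoint A} {D : ℕ} {v : ℝ} {a : A} {p q : ℤ}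

/-- A finite-range interaction on the chain: its terms `Φ x`, attached to the sites `x`, are
uniformly bounded by `v` and commute when they are at distance at least `D`. -/
structure IsFiniteRange (Φ : ℤ → selfAdjoint A) (D : ℕ) (v : ℝ) : Prop where
  commute : ∀ {x y : ℤ}, D ≤ |x - y| → Commute (Φ x : A) (Φ y)
  norm_le : ∀ x, ‖(Φ x : A)‖ ≤ v

/-- Only the interaction terms at the sites strictly between `p` and `q` can fail to commute with
`a`: this is all that the propagation bounds use about the support of `a`. -/
def IsLocalizedIn (Φ : ℤ → selfAdjoint A) (a : A) (p q : ℤ) : Prop :=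
  ∀ x, x ∉ Set.Ioo p q → Commute (Φ x : A) a

/-- The Hamiltonian with the interaction terms at the sites of `S`. -/
def hamiltonian (Φ : ℤ → selfAdjoint A) (S : Finset ℤ) : selfAdjoint A := ∑ x ∈ S, Φ x

theorem coe_hamiltonian (Φ : ℤ → selfAdjoint A) (S : Finset ℤ) :
    (hamiltonian Φ S : A) = ∑ x ∈ S, (Φ x : A) := AddSubgroup.val_finsetSum _ _ _

theorem commute_hamiltonian {S : Finset ℤ} {b : A} (hb : ∀ x ∈ S, Commute (Φ x : A) b) :
    Commute (hamiltonian Φ S : A) b := by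
  rw [coe_hamiltonian]
  exact Commute.sum_left _ _ _ hb

theorem hamiltonian_sdiff_add {S T : Finset ℤ} (hST : S ⊆ T) :
    (hamiltonian Φ (T \ S) + hamiltonian Φ S : A) = hamiltonian Φ T := by
  simp only [coe_hamiltonian, Finset.sum_sdiff hST]

/-- The sites of `S` strictly between `p - r` and `q + r`. -/
def near (S : Finset ℤ) (p q : ℤ) (r : ℕ) : Finset ℤ := S ∩ Finset.Ioo (p - r) (q + r)

theorem mem_near {S : Finset ℤ} {x : ℤ} {r : ℕ} :
    x ∈ near S p q r ↔ x ∈ S ∧ p - r < x ∧ x < q + r := by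
  rw [near, Finset.mem_inter, Finset.mem_Ioo]

theorem near_subset (S : Finset ℤ) (r : ℕ) : near S p q r ⊆ S := Finset.inter_subset_left

theorem near_subset_near {S : Finset ℤ} {r s : ℕ} (hrs : r ≤ s) :
    near S p q r ⊆ near S p q s := fun x hx => by
  rw [mem_near] at hx ⊢
  exact ⟨hx.1, by omega, by omega⟩

theorem near_near {S : Finset ℤ} {r s : ℕ} (hrs : r ≤ s) :
    near (near S p q s) p q r = near S p q r := by
  ext x
  simp only [mem_near]
  grind

theorem card_near_sdiff_near_le (S : Finset ℤ) (r s : ℕ) :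
    (near S p q (r + s) \ near S p q r).card ≤ 2 * s := by
  have hsub : near S p q (r + s) \ near S p q r ⊆
      Finset.Ioc (p - (r + s)) (p - r) ∪ Finset.Ico (q + r) (q + (r + s)) := fun x hx => by
    simp only [Finset.mem_sdiff, mem_near, Finset.mem_union, Finset.mem_Ioc, Finset.mem_Ico] at hx ⊢
    grind
  refine (Finset.card_le_card hsub).trans ((Finset.card_union_le _ _).trans ?_)
  rw [Int.card_Ioc, Int.card_Ico]
  omega

namespace IsFiniteRange

variable (hΦ : IsFiniteRange Φ D v)
include hΦ

theorem norm_hamiltonian_le (S : Finset ℤ) : ‖(hamiltonian Φ S : A)‖ ≤ S.card * v := by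
  rw [coe_hamiltonian, ← nsmul_eq_mul]
  exact norm_sum_le_of_le _ (fun x _ => hΦ.norm_le x) |>.trans_eq (Finset.sum_const v)

theorem norm_lie_hamiltonian_le (ha : IsLocalizedIn Φ a p q) (S : Finset ℤ) :
    ‖⁅(hamiltonian Φ S : A), a⁆‖ ≤ 2 * ((q - p).toNat * v) * ‖a‖ := by
  have hv : 0 ≤ v := (norm_nonneg _).trans (hΦ.norm_le 0)
  have hfar : Commute (hamiltonian Φ (S \ near S p q 0) : A) a := commute_hamiltonian fun x hx =>
    ha x fun hxpq => by
      rw [Finset.mem_sdiff, mem_near] at hx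
      exact hx.2 ⟨hx.1, by simpa using hxpq.1, by simpa using hxpq.2⟩
  have hcard : (near S p q 0).card ≤ (q - p).toNat := by
    refine (Finset.card_le_card Finset.inter_subset_right).trans ?_
    rw [Int.card_Ioo]
    omega
  calc ‖⁅(hamiltonian Φ S : A), a⁆‖ = ‖⁅(hamiltonian Φ (near S p q 0) : A), a⁆‖ := by
        rw [← hamiltonian_sdiff_add (near_subset S 0), Ring.lie_def, add_mul, mul_add, hfar.eq,
          add_sub_add_left_eq_sub, Ring.lie_def]
    _ ≤ 2 * ‖(hamiltonian Φ (near S p q 0) : A)‖ * ‖a‖ := norm_lie_le _ _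
    _ ≤ 2 * ((q - p).toNat * v) * ‖a‖ := by
        gcongr
        exact (hΦ.norm_hamiltonian_le _).trans (by gcongr)

theorem mono {D' : ℕ} (hD : D ≤ D') : IsFiniteRange Φ D' v where
  commute hxy := hΦ.commute (le_trans (by exact_mod_cast hD) hxy)
  norm_le := hΦ.norm_le

theorem commute_hamiltonian_heisenberg (ha : IsLocalizedIn Φ a p q) {S S' : Finset ℤ}
    (hS : ∀ x ∈ S, x ∉ Set.Ioo p q) (hSS' : ∀ x ∈ S, ∀ y ∈ S', D ≤ |x - y|) (t : ℝ) :
    Commute (hamiltonian Φ S : A) (heisenberg (hamiltonian Φ S') t a) :=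
  commute_heisenberg
    (commute_hamiltonian fun x hx => (commute_hamiltonian fun y hy =>
      (hΦ.commute (hSS' x hx y hy)).symm).symm)
    (commute_hamiltonian fun x hx => ha x (hS x hx)) t

/-- The terms of `S` outside the neighbourhood of radius `r + D` act on the evolved observable only
through those of the shell of width `D` around it, and the shell does not see the evolution in the
neighbourhood of radius `r`. -/
theorem norm_lie_hamiltonian_sub_le (ha : IsLocalizedIn Φ a p q) (S : Finset ℤ) (r : ℕ) (t : ℝ) :
    ‖⁅(hamiltonian Φ (near S p q (r + D)) - hamiltonian Φ S : A),
        heisenberg (hamiltonian Φ (near S p q (r + D))) t a⁆‖ ≤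
      4 * D * v * ‖heisenberg (hamiltonian Φ (near S p q (r + D))) t a -
        heisenberg (hamiltonian Φ (near S p q r)) t a‖ := by
  set X := heisenberg (hamiltonian Φ (near S p q (r + D))) t a
  set Y := heisenberg (hamiltonian Φ (near S p q r)) t a
  set V := hamiltonian Φ (near S p q (r + D + D) \ near S p q (r + D)) with hV
  set W := hamiltonian Φ (S \ near S p q (r + D + D)) with hW
  have hVY : Commute (V : A) Y := by
    refine hΦ.commute_hamiltonian_heisenberg ha (fun x hx => ?_) (fun x hx y hy => ?_) t <;>
      simp only [Finset.mem_sdiff, mem_near, Set.mem_Ioo, le_abs] at * <;> grind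
  have hWX : Commute (W : A) X := by
    refine hΦ.commute_hamiltonian_heisenberg ha (fun x hx => ?_) (fun x hx y hy => ?_) t <;>
      simp only [Finset.mem_sdiff, mem_near, Set.mem_Ioo, le_abs] at * <;> grind
  have hsplit : (hamiltonian Φ (near S p q (r + D)) - hamiltonian Φ S : A) = -(V + W : A) := by
    rw [← hamiltonian_sdiff_add (near_subset S (r + D + D)),
      ← hamiltonian_sdiff_add (near_subset_near (Nat.le_add_right (r + D) D)), ← hV, ← hW]
    abel
  have hlie : ⁅-(V + W : A), X⁆ = -⁅(V : A), X - Y⁆ := by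
    simp only [Ring.lie_def, neg_mul, mul_neg, add_mul, mul_add, mul_sub, sub_mul, hWX.eq, hVY.eq]
    abel
  have hVnorm : ‖(V : A)‖ ≤ 2 * D * v := by
    have hv : 0 ≤ v := (norm_nonneg _).trans (hΦ.norm_le 0)
    refine (hΦ.norm_hamiltonian_le _).trans (mul_le_mul_of_nonneg_right ?_ hv)
    exact_mod_cast card_near_sdiff_near_le S (r + D) D
  calc _ = ‖⁅(V : A), X - Y⁆‖ := by rw [hsplit, hlie, norm_neg]
    _ ≤ 2 * ‖(V : A)‖ * ‖X - Y‖ := norm_lie_le _ _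
    _ ≤ 2 * (2 * D * v) * ‖X - Y‖ := by gcongr
    _ = _ := by ring

theorem norm_heisenberg_sub_near_le (ha : IsLocalizedIn Φ a p q) (k : ℕ) (S : Finset ℤ) (t : ℝ) :
    ‖heisenberg (hamiltonian Φ S) t a - heisenberg (hamiltonian Φ (near S p q (k * D))) t a‖ ≤
      2 * ‖a‖ * ((4 * D * v * |t|) ^ k / k.factorial) := by
  induction k generalizing S t with
  | zero =>
    refine (norm_sub_le _ _).trans_eq ?_
    simp only [StarAlgEquiv.norm_map, pow_zero, Nat.factorial_zero, Nat.cast_one]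
    ring
  | succ k ih =>
    have hv : 0 ≤ v := (norm_nonneg _).trans (hΦ.norm_le 0)
    rw [Nat.succ_mul]
    refine (norm_heisenberg_sub_le (4 * D * v * (2 * ‖a‖ * ((4 * D * v) ^ k / k.factorial))) k t
      fun u _ => ?_).trans_eq ?_
    · have hu := ih (near S p q (k * D + D)) u
      rw [near_near (Nat.le_add_right _ _)] at hu
      calc _ ≤ 4 * D * v * _ := hΦ.norm_lie_hamiltonian_sub_le ha S (k * D) u
        _ ≤ 4 * D * v * (2 * ‖a‖ * ((4 * D * v * |u|) ^ k / k.factorial)) := by gcongr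
        _ = _ := by rw [mul_pow _ |u|]; ring
    · rw [Nat.factorial_succ]
      push_cast
      field_simp
      rw [mul_pow (4 * D * v), pow_succ (4 * D * v)]
      ring

theorem exists_norm_heisenberg_sub_near_le (T : ℝ) :
    ∃ C, 2 ≤ C ∧ ∀ {a : A} {p q : ℤ}, IsLocalizedIn Φ a p q → ∀ (S : Finset ℤ) (r : ℕ) {t : ℝ},
      |t| ≤ T →
      ‖heisenberg (hamiltonian Φ S) t a - heisenberg (hamiltonian Φ (near S p q r)) t a‖ ≤
        C * ‖a‖ * Real.exp (-r) := by
  have hv : 0 ≤ v := (norm_nonneg _).trans (hΦ.norm_le 0)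
  let E := D + 1
  let c := 4 * E * v * |T|
  refine ⟨4 * Real.exp (c * Real.exp E) * Real.exp E, ?_, fun {a p q} ha S r t ht => ?_⟩
  · have h1 : 1 ≤ Real.exp (c * Real.exp E) := Real.one_le_exp (by positivity)
    have h2 : 1 ≤ Real.exp E := Real.one_le_exp (by positivity)
    nlinarith
  let k := r / E
  have hkr : k * E ≤ r := Nat.div_mul_le_self r E
  have hrk : (r : ℝ) ≤ k * E + E := by
    exact_mod_cast (Nat.lt_div_mul_add (a := r) (Nat.succ_pos D)).le
  have hk (S : Finset ℤ) : ‖heisenberg (hamiltonian Φ S) t a -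
      heisenberg (hamiltonian Φ (near S p q (k * E))) t a‖ ≤
      2 * ‖a‖ * (Real.exp (c * Real.exp E) * (Real.exp E * Real.exp (-r))) := by
    refine ((hΦ.mono (Nat.le_succ D)).norm_heisenberg_sub_near_le ha k S t).trans ?_
    gcongr
    calc (4 * E * v * |t|) ^ k / k.factorial
        ≤ c ^ k / k.factorial := by
          gcongr
          exact mul_le_mul_of_nonneg_left (ht.trans (le_abs_self T)) (by positivity)
      _ ≤ Real.exp (c * Real.exp E) * Real.exp (-(k * E)) :=
          pow_div_factorial_le_exp_mul_exp (by positivity) k E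
      _ ≤ _ := by
        rw [← Real.exp_add E]
        gcongr
        linarith
  have hkS := hk S
  have hkr := hk (near S p q r)
  rw [near_near ‹_›, norm_sub_rev] at hkr
  linarith [norm_sub_le_norm_sub_add_norm_sub (heisenberg (hamiltonian Φ S) t a)
    (heisenberg (hamiltonian Φ (near S p q (k * E))) t a)
    (heisenberg (hamiltonian Φ (near S p q r)) t a)]

theorem exists_norm_heisenberg_sub_heisenberg_le (T : ℝ) :
    ∃ C, ∀ {a : A} {p q : ℤ}, IsLocalizedIn Φ a p q → ∀ (r : ℕ) {S S' : Finset ℤ},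
      (∀ x, p - r < x → x < q + r → (x ∈ S ↔ x ∈ S')) → ∀ {t : ℝ}, |t| ≤ T →
      ‖heisenberg (hamiltonian Φ S) t a - heisenberg (hamiltonian Φ S') t a‖ ≤
        C * ‖a‖ * Real.exp (-r) := by
  obtain ⟨C, -, hC⟩ := hΦ.exists_norm_heisenberg_sub_near_le T
  refine ⟨2 * C, fun {a p q} ha r S S' hS t ht => ?_⟩
  have hnear : near S p q r = near S' p q r := by
    ext x
    simp only [mem_near]
    exact and_congr_left fun hx => hS x hx.1 hx.2
  have hS := hC ha S r ht
  have hS' := hC ha S' r ht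
  rw [← hnear, norm_sub_rev] at hS'
  linarith [norm_sub_le_norm_sub_add_norm_sub (heisenberg (hamiltonian Φ S) t a)
    (heisenberg (hamiltonian Φ (near S p q r)) t a) (heisenberg (hamiltonian Φ S') t a)]

end IsFiniteRange

end LiebRobinson

section FiniteVolume

variable {N d d' dh : ℕ} {h : LocalMatrix N dh}

theorem isClosed_range_observable (x : ℤ) :
    IsClosed ((observable x : LocalMatrix N d →⋆ₐ[ℂ] QuasiLocal N).range : Set (QuasiLocal N)) :=
  Submodule.closed_of_finiteDimensional
    (LinearMap.range (observable x : LocalMatrix N d →⋆ₐ[ℂ] QuasiLocal N).toLinearMap)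

theorem observable_mem_range_of_subwindow {x y : ℤ} (hyx : y ≤ x) (hxy : x + d ≤ y + d')
    (M : LocalMatrix N d) :
    observable x M ∈ (observable y : LocalMatrix N d' →⋆ₐ[ℂ] QuasiLocal N).range := by
  obtain ⟨M', hM'⟩ := localAlgebra_subset_of_subwindow hyx hxy (Set.mem_range_self M)
  exact ⟨M', Subtype.ext hM'⟩

/-- The translates `h_x` of the interaction density `h`. -/
def interaction (hh : h.IsHermitian) (x : ℤ) : selfAdjoint (QuasiLocal N) :=
  ⟨observable x h, isSelfAdjoint_observable x hh⟩

theorem coe_interaction (hh : h.IsHermitian) (x : ℤ) :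
    (interaction hh x : QuasiLocal N) = observable x h := rfl

theorem isFiniteRange_interaction (hh : h.IsHermitian) :
    IsFiniteRange (interaction hh) dh ‖(observable 0 h : QuasiLocal N)‖ where
  commute {x y} hxy := commute_observable_of_disjoint
    (by rcases le_abs.1 hxy with hxy | hxy <;> simp only [DisjointWindows] <;> omega) h h
  norm_le x := (norm_observable x h).le

theorem isLocalizedIn_observable (hh : h.IsHermitian) (y : ℤ) (M : LocalMatrix N d) :
    IsLocalizedIn (interaction hh) (observable y M) (y - dh) (y + d) := fun x hx =>
  commute_observable_of_disjoint
    (by simp only [Set.mem_Ioo, DisjointWindows] at hx ⊢; omega) h M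

/-- Heisenberg evolution generated by the terms `h_x` with `x ∈ S`. -/
abbrev finiteFlow (hh : h.IsHermitian) (S : Finset ℤ) (t : ℝ) : QuasiLocal N ≃⋆ₐ[ℂ] QuasiLocal N :=
  heisenberg (hamiltonian (interaction hh) S) t

theorem coe_hamiltonian_interaction (hh : h.IsHermitian) (a b : ℤ) :
    ((hamiltonian (interaction hh) (Finset.Icc a (b - dh + 1)) : QuasiLocal N) : Op N) =
      homogeneousSum h a b := by
  rw [coe_hamiltonian]
  exact map_sum (quasiLocalAlgebra N).subtype _ _

theorem finiteEvolution_eq (hh : h.IsHermitian) (a b : ℤ) (t : ℝ) (A : QuasiLocal N) :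
    finiteEvolution h a b t A = (finiteFlow hh (Finset.Icc a (b - dh + 1)) t A : Op N) := by
  let _ : NormedAlgebra ℚ (QuasiLocal N) := .restrictScalars ℚ ℂ (QuasiLocal N)
  let _ : NormedAlgebra ℚ (Op N) := .restrictScalars ℚ ℂ (Op N)
  have hexp (X : QuasiLocal N) : ((NormedSpace.exp X : QuasiLocal N) : Op N) =
      NormedSpace.exp (X : Op N) :=
    NormedSpace.map_exp (𝔸 := QuasiLocal N) (quasiLocalAlgebra N).subtype
      continuous_subtype_val X
  have hX : (Complex.I * t) • homogeneousSum h a b = ((t • Complex.I •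
      (hamiltonian (interaction hh) (Finset.Icc a (b - dh + 1)) : QuasiLocal N) :
        QuasiLocal N) : Op N) := by
    rw [← coe_hamiltonian_interaction hh, mul_comm, mul_smul]
    rfl
  rw [finiteEvolution, finiteFlow, heisenberg_apply, neg_smul, hX, ← hexp]
  exact congrArg _ (hexp (-_)).symm

theorem finiteFlow_near_mem_range (hh : h.IsHermitian) (M : LocalMatrix N d) (y : ℤ)
    (S : Finset ℤ) (r : ℕ) (t : ℝ) :
    finiteFlow hh (near S (y - dh) (y + d) r) t (observable y M) ∈
      (observable (y - dh - r) : LocalMatrix N (d + 2 * (dh + r)) →⋆ₐ[ℂ] QuasiLocal N).range := by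
  refine heisenberg_mem (isClosed_range_observable _) ?_
    (observable_mem_range_of_subwindow (by omega) (by push_cast; omega) M) t
  rw [coe_hamiltonian]
  refine sum_mem fun x hx => ?_
  have hx := mem_near.1 hx
  exact observable_mem_range_of_subwindow (by omega) (by push_cast; omega) h

theorem trace_mul_finiteFlow_near_eq_zero [NeZero N] (hh : h.IsHermitian) (M : LocalMatrix N d)
    {M' : LocalMatrix N d'} (hM' : trace N (observable 0 M') = 0) {x y : ℤ} {r : ℕ}
    (hr : (d + d' + dh : ℕ) + (r : ℤ) ≤ |x - y|) (S : Finset ℤ) (t : ℝ) :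
    trace N (observable x M' *
      finiteFlow hh (near S (y - dh) (y + d) r) t (observable y M)) = 0 := by
  obtain ⟨L, hL⟩ := finiteFlow_near_mem_range hh M y S r t
  have hdisj : DisjointWindows x d' (y - dh - r) (d + 2 * (dh + r)) := by
    rcases abs_cases (x - y) with hxy | hxy <;> simp only [DisjointWindows] <;> push_cast <;>
      omega
  rw [← hL]
  refine (trace_mul_observable_of_disjoint hdisj M' L).trans ?_
  rw [trace_observable, ← trace_observable 0, hM', zero_mul]

theorem exists_norm_trace_mul_finiteFlow_le [NeZero N] (hh : h.IsHermitian) (M : LocalMatrix N d)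
    {M' : LocalMatrix N d'} (hM' : trace N (observable 0 M') = 0) (T : ℝ) :
    ∃ C, ∀ (x y : ℤ) (S : Finset ℤ) {t : ℝ}, |t| ≤ T →
      ‖trace N (observable x M' * finiteFlow hh S t (observable y M))‖ ≤
        C * Real.exp (-(|x - y| : ℤ)) := by
  obtain ⟨C, hC2, hC⟩ := (isFiniteRange_interaction hh).exists_norm_heisenberg_sub_near_le T
  have htr := isTracialState_trace (N := N)
  let K := d + d' + dh
  let m := ‖observable (N := N) 0 M‖
  let m' := ‖observable (N := N) 0 M'‖
  suffices hK : ∀ (x y : ℤ) (S : Finset ℤ) {t : ℝ}, |t| ≤ T →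
      ‖trace N (observable x M' * finiteFlow hh S t (observable y M))‖ ≤
        m' * (C * m * Real.exp (K - (|x - y| : ℤ))) by
    refine ⟨m' * (C * m * Real.exp K), fun x y S t ht => (hK x y S ht).trans_eq ?_⟩
    rw [sub_eq_add_neg, Real.exp_add]
    ring
  intro x y S t ht
  rcases lt_or_ge |x - y| K with hxy | hxy
  · have hexp : 1 ≤ Real.exp (K - (|x - y| : ℤ)) :=
      Real.one_le_exp (sub_nonneg.2 (by exact_mod_cast hxy.le))
    calc _ ≤ ‖observable x M' * finiteFlow hh S t (observable y M)‖ := htr.norm_le _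
      _ ≤ m' * m := by
        refine (norm_mul_le _ _).trans_eq ?_
        rw [StarAlgEquiv.norm_map, norm_observable x, norm_observable y]
      _ ≤ _ := by
        gcongr
        rw [mul_right_comm]
        exact le_mul_of_one_le_left (norm_nonneg _) (by nlinarith)
  · obtain ⟨r, hr⟩ := Int.eq_ofNat_of_zero_le (sub_nonneg.2 hxy)
    have hzero := trace_mul_finiteFlow_near_eq_zero hh M hM' (x := x) (y := y) (r := r)
      (by omega) S t
    have hr' : (K - (|x - y| : ℤ) : ℝ) = -r := by
      rw [← neg_sub, neg_inj]
      exact_mod_cast hr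
    calc _ = ‖trace N (observable x M' * (finiteFlow hh S t (observable y M) -
            finiteFlow hh (near S (y - dh) (y + d) r) t (observable y M)))‖ := by
          rw [mul_sub, map_sub, hzero, sub_zero]
      _ ≤ m' * (C * m * Real.exp (-r)) := by
          refine (htr.norm_le _).trans ((norm_mul_le _ _).trans ?_)
          rw [norm_observable x]
          have := hC (isLocalizedIn_observable hh y M) S r ht
          rw [norm_observable y] at this
          gcongr
      _ = _ := by rw [hr']

end FiniteVolume

section InfiniteVolume

theorem exists_tendsto_of_forall_eventually_dist_lt {α ι : Type*} [MetricSpace α] [CompleteSpace α]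
    {l : Filter ι} [l.NeBot] {f : ι → α} (hf : ∀ ε > 0, ∃ z, ∀ᶠ i in l, dist (f i) z < ε) :
    ∃ z, Tendsto f l (𝓝 z) := by
  refine CompleteSpace.complete (Metric.cauchy_iff.2 ⟨inferInstance, fun ε hε => ?_⟩)
  obtain ⟨z, hz⟩ := hf (ε / 2) (half_pos hε)
  refine ⟨Metric.ball z (ε / 2), hz, fun x hx y hy => ?_⟩
  rw [Metric.mem_ball] at hx hy
  linarith [dist_triangle_right x y z]

theorem exists_const_mul_exp_neg_lt (C : ℝ) {ε : ℝ} (hε : 0 < ε) :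
    ∃ r : ℕ, C * Real.exp (-r) < ε := by
  have hlim : Tendsto (fun r : ℕ => C * Real.exp (-(r : ℝ))) atTop (𝓝 (C * 0)) :=
    (Real.tendsto_exp_neg_atTop_nhds_zero.comp tendsto_natCast_atTop_atTop).const_mul C
  rw [mul_zero] at hlim
  exact (hlim.eventually (gt_mem_nhds hε)).exists

theorem tendsto_atBot_prod_atTop_add (a b : ℤ) :
    Tendsto (fun p : ℤ × ℤ => (p.1 + a, p.2 + b)) (atBot ×ˢ atTop) (atBot ×ˢ atTop) :=
  (tendsto_atBot_add_const_right _ a tendsto_id).prodMap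
    (tendsto_atTop_add_const_right _ b tendsto_id)

variable {N d d' dh : ℕ} {h : LocalMatrix N dh}

theorem exists_tendsto_finiteFlow (hh : h.IsHermitian) (t : ℝ) (A : QuasiLocal N) :
    ∃ B, Tendsto (fun p : ℤ × ℤ => finiteFlow hh (Finset.Icc p.1 p.2) t A) (atBot ×ˢ atTop)
      (𝓝 B) := by
  obtain ⟨C, hC⟩ := (isFiniteRange_interaction hh).exists_norm_heisenberg_sub_heisenberg_le |t|
  refine exists_tendsto_of_forall_eventually_dist_lt fun ε hε => ?_
  obtain ⟨y, d, M, hM⟩ := exists_observable_norm_sub_lt A (half_pos hε)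
  obtain ⟨r, hr⟩ := exists_const_mul_exp_neg_lt (C * ‖observable y M‖) (half_pos hε)
  let S := Finset.Icc (y - dh - r) (y + d + r)
  refine ⟨finiteFlow hh S t (observable y M), ?_⟩
  filter_upwards [(eventually_le_atBot (y - dh - r)).prod_mk (eventually_ge_atTop (y + d + r))]
    with p hp
  have happrox : ‖finiteFlow hh (Finset.Icc p.1 p.2) t A -
      finiteFlow hh (Finset.Icc p.1 p.2) t (observable y M)‖ < ε / 2 := by
    rwa [← map_sub, StarAlgEquiv.norm_map]
  have hlocal := hC (isLocalizedIn_observable hh y M) r (S := Finset.Icc p.1 p.2) (S' := S)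
    (fun x hx hx' => by simp only [S, Finset.mem_Icc]; omega) (t := t) le_rfl
  rw [dist_eq_norm]
  linarith [norm_sub_le_norm_sub_add_norm_sub (finiteFlow hh (Finset.Icc p.1 p.2) t A)
    (finiteFlow hh (Finset.Icc p.1 p.2) t (observable y M)) (finiteFlow hh S t (observable y M))]

theorem tendsto_limUnder_finiteFlow (hh : h.IsHermitian) (t : ℝ) (A : QuasiLocal N) :
    Tendsto (fun p : ℤ × ℤ => finiteFlow hh (Finset.Icc p.1 p.2) t A) (atBot ×ˢ atTop)
      (𝓝 (limUnder (atBot ×ˢ atTop)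
        fun p : ℤ × ℤ => finiteFlow hh (Finset.Icc p.1 p.2) t A)) :=
  tendsto_nhds_limUnder (exists_tendsto_finiteFlow hh t A)

/-- Heisenberg evolution of the infinite chain, as a map of the quasi-local algebra. -/
def flow (hh : h.IsHermitian) (t : ℝ) : QuasiLocal N →ₗ[ℂ] QuasiLocal N :=
  linearMapOfTendsto _
    (fun p : ℤ × ℤ => (finiteFlow hh (Finset.Icc p.1 p.2) t : QuasiLocal N →ₗ[ℂ] QuasiLocal N))
    (tendsto_pi_nhds.2 (tendsto_limUnder_finiteFlow hh t))

theorem tendsto_finiteFlow (hh : h.IsHermitian) (t : ℝ) (A : QuasiLocal N) :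
    Tendsto (fun p : ℤ × ℤ => finiteFlow hh (Finset.Icc p.1 p.2) t A) (atBot ×ˢ atTop)
      (𝓝 (flow hh t A)) :=
  tendsto_limUnder_finiteFlow hh t A

theorem tendsto_finiteEvolution_flow (hh : h.IsHermitian) (t : ℝ) (A : QuasiLocal N) :
    Tendsto (fun p : ℤ × ℤ => finiteEvolution h p.1 p.2 t A) (atBot ×ˢ atTop)
      (𝓝 (flow hh t A : Op N)) := by
  have hlim := (continuous_subtype_val.tendsto _).comp
    ((tendsto_finiteFlow hh t A).comp (tendsto_atBot_prod_atTop_add 0 (1 - dh)))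
  refine hlim.congr fun p => ?_
  rw [finiteEvolution_eq hh, sub_add_comm, add_comm _ p.2, ← add_zero p.1]
  rfl

theorem coe_flow (hh : h.IsHermitian) (t : ℝ) (A : QuasiLocal N) :
    (flow hh t A : Op N) = evolution h t A :=
  (tendsto_finiteEvolution_flow hh t A).limUnder_eq.symm

theorem translate_heisenberg (c : ℤ) (H : selfAdjoint (QuasiLocal N)) (t : ℝ) (A : QuasiLocal N) :
    translate c (heisenberg H t A) =
      heisenberg ⟨translate c (H : QuasiLocal N), H.2.map (translate c)⟩ t (translate c A) := by
  let _ : NormedAlgebra ℚ (QuasiLocal N) := .restrictScalars ℚ ℂ (QuasiLocal N)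
  have hsmul (r : ℝ) (X : QuasiLocal N) : translate c (r • X) = r • translate c X :=
    map_smul ((translate c).restrictScalars ℝ) r X
  simp only [heisenberg_apply, map_mul, NormedSpace.map_exp _ (continuous_translate c), map_neg,
    hsmul, map_smul]

theorem translate_finiteFlow (hh : h.IsHermitian) (a b c : ℤ) (t : ℝ) (A : QuasiLocal N) :
    translate c (finiteFlow hh (Finset.Icc a b) t A) =
      finiteFlow hh (Finset.Icc (a + c) (b + c)) t (translate c A) := by
  have hH : translate c (hamiltonian (interaction hh) (Finset.Icc a b) : QuasiLocal N) =
      hamiltonian (interaction hh) (Finset.Icc (a + c) (b + c)) := by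
    simp only [coe_hamiltonian, map_sum, coe_interaction, translate_observable,
      ← Finset.image_add_right_Icc, Finset.sum_image (add_left_injective c).injOn]
  rw [finiteFlow, translate_heisenberg]
  simp only [hH]

theorem translate_flow (hh : h.IsHermitian) (c : ℤ) (t : ℝ) (A : QuasiLocal N) :
    translate c (flow hh t A) = flow hh t (translate c A) := by
  refine tendsto_nhds_unique
    (((continuous_translate c).tendsto _).comp (tendsto_finiteFlow hh t A))
    (((tendsto_finiteFlow hh t (translate c A)).comp
      (tendsto_atBot_prod_atTop_add c c)).congr fun p => ?_)
  exact (translate_finiteFlow hh p.1 p.2 c t A).symm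

theorem exists_norm_flow_sub_finiteFlow_le (hh : h.IsHermitian) (M : LocalMatrix N d) (T : ℝ) :
    ∃ C, ∀ (y : ℤ) (r : ℕ) {S : Finset ℤ},
      (∀ x, y - dh - r < x → x < y + d + r → x ∈ S) → ∀ {t : ℝ}, |t| ≤ T →
      ‖flow hh t (observable y M) - finiteFlow hh S t (observable y M)‖ ≤ C * Real.exp (-r) := by
  obtain ⟨C, hC⟩ := (isFiniteRange_interaction hh).exists_norm_heisenberg_sub_heisenberg_le T
  refine ⟨C * ‖observable (N := N) 0 M‖, fun y r S hS t ht => ?_⟩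
  refine le_of_tendsto ((tendsto_finiteFlow hh t (observable y M)).sub_const _).norm ?_
  filter_upwards [(eventually_le_atBot (y - dh - r)).prod_mk (eventually_ge_atTop (y + d + r))]
    with p hp
  rw [← norm_observable y]
  refine hC (isLocalizedIn_observable hh y M) r (fun x hx hx' => ?_) ht
  simp only [hS x hx hx', iff_true, Finset.mem_Icc]
  omega

theorem continuous_flow_observable (hh : h.IsHermitian) (M : LocalMatrix N d) (y : ℤ) :
    Continuous fun t => flow hh t (observable y M) := by
  refine continuous_iff_continuousAt.2 fun t =>
    continuousAt_of_locally_uniform_approx_of_continuousAt fun u hu => ?_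
  obtain ⟨ε, hε, hεu⟩ := Metric.mem_uniformity_dist.1 hu
  obtain ⟨C, hC⟩ := exists_norm_flow_sub_finiteFlow_le hh M (|t| + 1)
  obtain ⟨r, hr⟩ := exists_const_mul_exp_neg_lt C hε
  refine ⟨Metric.ball t 1, Metric.ball_mem_nhds t one_pos,
    fun s => finiteFlow hh (Finset.Icc (y - dh - r) (y + d + r)) s (observable y M),
    (continuous_heisenberg_time _ _).continuousAt, fun s hs => hεu ?_⟩
  rw [dist_eq_norm]
  refine (hC y r (fun x hx hx' => Finset.mem_Icc.2 ⟨hx.le, hx'.le⟩) ?_).trans_lt hr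
  rw [Metric.mem_ball, Real.dist_eq] at hs
  linarith [abs_sub_abs_le_abs_sub s t]

variable [NeZero N]

theorem exists_norm_trace_mul_flow_le (hh : h.IsHermitian) (M : LocalMatrix N d)
    {M' : LocalMatrix N d'} (hM' : trace N (observable 0 M') = 0) (T : ℝ) :
    ∃ C, ∀ (x y : ℤ) {t : ℝ}, |t| ≤ T →
      ‖trace N (observable x M' * flow hh t (observable y M))‖ ≤
        C * Real.exp (-(|x - y| : ℤ)) := by
  obtain ⟨C, hC⟩ := exists_norm_trace_mul_finiteFlow_le hh M hM' T
  refine ⟨C, fun x y t ht => ?_⟩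
  have hcont : Continuous fun A => trace N (observable x M' * A) := by fun_prop
  exact le_of_tendsto ((hcont.tendsto _).comp (tendsto_finiteFlow hh t (observable y M))).norm
    (Eventually.of_forall fun p => hC x y _ ht)

theorem trace_observable_add_mul_flow (hh : h.IsHermitian) (M : LocalMatrix N d)
    (M' : LocalMatrix N d') (x y c : ℤ) (t : ℝ) :
    trace N (observable (x + c) M' * flow hh t (observable (y + c) M)) =
      trace N (observable x M' * flow hh t (observable y M)) := by
  rw [← trace_translate c (observable x M' * _), map_mul (translate c), translate_observable,
    translate_flow, translate_observable]

theorem trace_observable_add_mul_observable (M : LocalMatrix N d) (M' : LocalMatrix N d')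
    (x y c : ℤ) :
    trace N (observable (x + c) M' * observable (y + c) M) =
      trace N (observable x M' * observable y M) := by
  rw [← trace_translate c (observable x M' * _), map_mul (translate c), translate_observable,
    translate_observable]

end InfiniteVolume

section Averages

variable {ι : Type*}

theorem tendsto_average_zero {E : Type*} [NormedAddCommGroup E] [NormedSpace ℝ E] {I : ℕ → Finset ℤ}
    (hI : ∀ n, I n ⊆ Finset.Icc 1 (n + 1)) {u : ℕ → ℤ → E} {g : ℝ} (hu : ∀ n y, ‖u n y‖ ≤ g)
    (hbulk : ∀ ε > 0, ∃ r : ℕ, ∀ (n : ℕ) (y : ℤ), r ≤ y → y ≤ n - r → ‖u n y‖ ≤ ε) :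
    Tendsto (fun n : ℕ => (n : ℝ)⁻¹ • ∑ y ∈ I n, u n y) atTop (𝓝 0) := by
  have hg : 0 ≤ g := (norm_nonneg _).trans (hu 0 0)
  rw [NormedAddGroup.tendsto_nhds_zero]
  intro ε hε
  obtain ⟨r, hr⟩ := hbulk (ε / 2) (half_pos hε)
  have hlim : Tendsto (fun n : ℕ => ε / 2 + (ε / 2 + 2 * (r + 1) * g) / n) atTop (𝓝 (ε / 2)) := by
    simpa only [add_zero] using (tendsto_const_div_atTop_nhds_zero_nat _).const_add (ε / 2)
  filter_upwards [hlim.eventually (gt_mem_nhds (half_lt_self hε)), eventually_gt_atTop 0]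
    with n hn hn0
  let edge := Finset.Icc 1 (r : ℤ) ∪ Finset.Icc (n - r + 1 : ℤ) (n + 1)
  have hedge : edge.card ≤ 2 * (r + 1) := by
    refine (Finset.card_union_le _ _).trans ?_
    simp only [Int.card_Icc]
    omega
  have hterm (y : ℤ) (hy : y ∈ I n) : ‖u n y‖ ≤ ε / 2 + if y ∈ edge then g else 0 := by
    split_ifs with hy'
    · linarith [hu n y]
    · have hyI := Finset.mem_Icc.1 (hI n hy)
      simp only [edge, Finset.mem_union, Finset.mem_Icc, not_or] at hy'
      linarith [hr n y (by omega) (by omega)]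
  have hsum : ‖∑ y ∈ I n, u n y‖ ≤ (n + 1) * (ε / 2) + 2 * (r + 1) * g := by
    refine (norm_sum_le_of_le _ hterm).trans ?_
    rw [Finset.sum_add_distrib, ← Finset.sum_filter, Finset.sum_const, Finset.sum_const,
      nsmul_eq_mul, nsmul_eq_mul]
    have hcardI : (I n).card ≤ n + 1 :=
      (Finset.card_le_card (hI n)).trans_eq (by rw [Int.card_Icc]; omega)
    have hcard : ((I n).filter (· ∈ edge)).card ≤ 2 * (r + 1) :=
      (Finset.card_le_card fun y hy => (Finset.mem_filter.1 hy).2).trans hedge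
    gcongr
    · exact_mod_cast hcardI
    · exact_mod_cast hcard
  calc ‖(n : ℝ)⁻¹ • ∑ y ∈ I n, u n y‖
      ≤ (n : ℝ)⁻¹ * ((n + 1) * (ε / 2) + 2 * (r + 1) * g) := by
        rw [norm_smul, norm_inv, Real.norm_natCast]
        gcongr
    _ = ε / 2 + (ε / 2 + 2 * (r + 1) * g) / n := by field_simp; ring
    _ < ε := hn

theorem tendsto_card_Icc_div (ℓ : ℕ) :
    Tendsto (fun n : ℕ => ((Finset.Icc (1 : ℤ) (n - ℓ + 1)).card : ℂ) / n) atTop (𝓝 1) := by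
  have hlim : Tendsto (fun n : ℕ => 1 + (1 - ℓ : ℂ) / n) atTop (𝓝 (1 + 0)) :=
    (tendsto_const_div_atTop_nhds_zero_nat _).const_add 1
  rw [add_zero] at hlim
  refine hlim.congr' ?_
  filter_upwards [eventually_ge_atTop (ℓ + 1)] with n hn
  have hn0 : (n : ℂ) ≠ 0 := by exact_mod_cast (by omega : n ≠ 0)
  have hcard : ((Finset.Icc (1 : ℤ) (n - ℓ + 1)).card : ℤ) = n - ℓ + 1 := by
    rw [Int.card_Icc]
    omega
  have hcard : ((Finset.Icc (1 : ℤ) (n - ℓ + 1)).card : ℂ) = n - ℓ + 1 := by exact_mod_cast hcard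
  rw [hcard]
  field_simp
  ring

/-- The contribution of the pairs of sites at distance `z` to the average over pairs of sites, in
`[1, n - ℓ i + 1]` and `[1, n - ℓ' i + 1]`, of the kernel `c n i`. -/
def diagonalAverage (ℓ ℓ' : ι → ℕ) (c : ℕ → ι → ℤ → ℤ → ℂ) (n : ℕ) (i : ι) (z : ℤ) : ℂ :=
  1 / (n : ℂ) * ∑ y ∈ Finset.Icc (1 : ℤ) (n - ℓ' i + 1),
    if y + z ∈ Finset.Icc (1 : ℤ) (n - ℓ i + 1) then c n i (y + z) y else 0

section

variable {ℓ ℓ' : ι → ℕ} {c : ℕ → ι → ℤ → ℤ → ℂ} {g : ι × ℤ → ℝ}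
  (hc : ∀ n i x y, ‖c n i x y‖ ≤ g (i, x - y))
include hc

theorem norm_ite_kernel_le (P : Prop) [Decidable P] (n : ℕ) (i : ι) (y z : ℤ) :
    ‖if P then c n i (y + z) y else 0‖ ≤ g (i, z) := by
  have h := hc n i (y + z) y
  rw [add_sub_cancel_left] at h
  split_ifs
  · exact h
  · exact norm_zero.trans_le ((norm_nonneg _).trans h)

theorem norm_diagonalAverage_le (n : ℕ) (i : ι) (z : ℤ) :
    ‖diagonalAverage ℓ ℓ' c n i z‖ ≤ 2 * g (i, z) := by
  have hg : 0 ≤ g (i, z) := (norm_nonneg _).trans (norm_ite_kernel_le hc True n i 0 z)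
  rcases Nat.eq_zero_or_pos n with rfl | hn
  · simpa [diagonalAverage] using hg
  have hcard : (Finset.Icc (1 : ℤ) (n - ℓ' i + 1)).card ≤ 2 * n := by
    rw [Int.card_Icc]
    omega
  calc ‖diagonalAverage ℓ ℓ' c n i z‖
      ≤ 1 / (n : ℝ) * ((2 * n : ℕ) * g (i, z)) := by
        rw [diagonalAverage, norm_mul, norm_div, norm_one, Complex.norm_natCast]
        gcongr
        refine (norm_sum_le_of_le _ fun y _ => norm_ite_kernel_le hc _ n i y z).trans ?_
        rw [Finset.sum_const, nsmul_eq_mul]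
        gcongr
    _ = 2 * g (i, z) := by
        push_cast
        field_simp

theorem tendsto_diagonalAverage {i : ι} {z : ℤ} {w : ℂ}
    (hbulk : ∀ ε > 0, ∃ r : ℕ, ∀ (n : ℕ) (y : ℤ), r ≤ y → y ≤ n - r → ‖c n i (y + z) y - w‖ ≤ ε) :
    Tendsto (fun n => diagonalAverage ℓ ℓ' c n i z) atTop (𝓝 w) := by
  let I (n : ℕ) := Finset.Icc (1 : ℤ) (n - ℓ' i + 1)
  let u (n : ℕ) (y : ℤ) : ℂ :=
    if y + z ∈ Finset.Icc (1 : ℤ) (n - ℓ i + 1) then c n i (y + z) y else 0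
  have hzero : Tendsto (fun n : ℕ => (n : ℝ)⁻¹ • ∑ y ∈ I n, (u n y - w)) atTop (𝓝 0) := by
    refine tendsto_average_zero (g := g (i, z) + ‖w‖)
      (fun n => Finset.Icc_subset_Icc le_rfl (by omega))
      (fun n y => (norm_sub_le _ _).trans
        (add_le_add_left (norm_ite_kernel_le hc _ n i y z) _)) fun ε hε => ?_
    obtain ⟨r, hr⟩ := hbulk ε hε
    refine ⟨r + z.natAbs + ℓ i + 1, fun n y hy hyn => ?_⟩
    have hyz : y + z ∈ Finset.Icc (1 : ℤ) (n - ℓ i + 1) := Finset.mem_Icc.2 (by omega)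
    simp only [u, if_pos hyz]
    exact hr n y (by omega) (by omega)
  have hlim := hzero.add ((tendsto_card_Icc_div (ℓ' i)).mul_const w)
  rw [zero_add, one_mul] at hlim
  refine hlim.congr fun n => ?_
  rw [Finset.sum_sub_distrib, Finset.sum_const, nsmul_eq_mul, Complex.real_smul, diagonalAverage]
  push_cast
  ring

end

theorem tsum_diagonalAverage {ℓ ℓ' : ι → ℕ} {s : ℕ → Finset ι}
    (hs : ∀ n, ∀ i ∉ s n, n < ℓ i ∨ n < ℓ' i) (c : ℕ → ι → ℤ → ℤ → ℂ) (n : ℕ) :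
    ∑' p : ι × ℤ, diagonalAverage ℓ ℓ' c n p.1 p.2 =
      1 / (n : ℂ) * ∑ i ∈ s n, ∑ x ∈ Finset.Icc (1 : ℤ) (n - ℓ i + 1),
        ∑ y ∈ Finset.Icc (1 : ℤ) (n - ℓ' i + 1), c n i x y := by
  rw [tsum_eq_sum (s := s n ×ˢ Finset.Icc (-(n : ℤ)) n), Finset.sum_product, Finset.mul_sum]
  · refine Finset.sum_congr rfl fun i _ => ?_
    simp only [diagonalAverage]
    rw [← Finset.mul_sum, Finset.sum_comm, Finset.sum_comm (s := Finset.Icc (1 : ℤ) (n - ℓ i + 1))]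
    congr 1
    refine Finset.sum_congr rfl fun y hy => ?_
    rw [← Finset.sum_filter]
    refine Finset.sum_nbij' (fun z => y + z) (fun x => x - y)
      (fun z hz => (Finset.mem_filter.1 hz).2) (fun x hx => ?_)
      (fun z _ => add_sub_cancel_left y z) (fun x _ => add_sub_cancel y x) (fun z _ => rfl)
    simp only [Finset.mem_filter, Finset.mem_Icc] at hx hy ⊢
    omega
  · rintro ⟨i, z⟩ hp
    rw [diagonalAverage, Finset.sum_eq_zero, mul_zero]
    refine fun y hy => if_neg fun hyz => ?_
    simp only [Finset.mem_product, not_and_or, Finset.mem_Icc] at hp hy hyz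
    rcases hp with hp | hp
    · rcases hs n i hp with h | h <;> omega
    · omega

theorem tendsto_pairAverage {ℓ ℓ' : ι → ℕ} {s : ℕ → Finset ι}
    (hs : ∀ n, ∀ i ∉ s n, n < ℓ i ∨ n < ℓ' i) {c : ℕ → ι → ℤ → ℤ → ℂ} {w : ι × ℤ → ℂ}
    {g : ι × ℤ → ℝ} (hg : Summable g) (hc : ∀ n i x y, ‖c n i x y‖ ≤ g (i, x - y))
    (hbulk : ∀ i z, ∀ ε > 0, ∃ r : ℕ, ∀ (n : ℕ) (y : ℤ), r ≤ y → y ≤ n - r →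
      ‖c n i (y + z) y - w (i, z)‖ ≤ ε) :
    Tendsto (fun n : ℕ => 1 / (n : ℂ) * ∑ i ∈ s n, ∑ x ∈ Finset.Icc (1 : ℤ) (n - ℓ i + 1),
      ∑ y ∈ Finset.Icc (1 : ℤ) (n - ℓ' i + 1), c n i x y) atTop (𝓝 (∑' p, w p)) :=
  (tendsto_tsum_of_dominated_convergence (hg.mul_left 2)
    (fun p => tendsto_diagonalAverage hc (hbulk p.1 p.2))
    (Eventually.of_forall fun n p => norm_diagonalAverage_le hc n p.1 p.2)).congr
    fun n => tsum_diagonalAverage hs c n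

theorem summable_exp_neg_mul_abs {δ : ℝ} (hδ : 0 < δ) :
    Summable fun z : ℤ => Real.exp (-(δ * (|z| : ℤ))) := by
  have hnat : Summable fun n : ℕ => Real.exp (n * -δ) :=
    Real.summable_exp_nat_mul_iff.2 (neg_lt_zero.2 hδ)
  refine Summable.of_nat_of_neg ?_ ?_ <;> simpa [mul_comm] using hnat

theorem summable_exp_neg_abs : Summable fun z : ℤ => Real.exp (-(|z| : ℤ)) := by
  simpa only [one_mul] using summable_exp_neg_mul_abs one_pos

end Averages

section TimeAverage

variable {C : ℝ → ℝ} {K : ℝ}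

/-- The primitive of `C` vanishing at `0`. -/
def primitive (C : ℝ → ℝ) (t : ℝ) : ℝ := ∫ s in (0 : ℝ)..t, C s

/-- The double integral of `C (s' - s)` over the square `[0, T]²`: the squared norm of the time
integral over `[0, T]` of a stationary process with correlation function `C`. -/
def squareIntegral (C : ℝ → ℝ) (T : ℝ) : ℝ := ∫ s in (0 : ℝ)..T, ∫ s' in (0 : ℝ)..T, C (s' - s)

theorem hasDerivAt_primitive (hC : Continuous C) (t : ℝ) : HasDerivAt (primitive C) (C t) t :=
  intervalIntegral.integral_hasDerivAt_right (hC.intervalIntegrable _ _)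
    (hC.stronglyMeasurableAtFilter _ _) hC.continuousAt

theorem continuous_primitive (hC : Continuous C) : Continuous (primitive C) :=
  continuous_iff_continuousAt.2 fun t => (hasDerivAt_primitive hC t).continuousAt

@[simp]
theorem primitive_zero : primitive C 0 = 0 := intervalIntegral.integral_same

theorem primitive_sub_primitive (hC : Continuous C) (s t : ℝ) :
    primitive C t - primitive C s = ∫ u in s..t, C u :=
  intervalIntegral.integral_interval_sub_left (hC.intervalIntegrable _ _)
    (hC.intervalIntegrable _ _)

theorem abs_primitive_sub_le (hC : Continuous C) (hK : ∀ t, |C t| ≤ K) (s t : ℝ) :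
    |primitive C t - primitive C s| ≤ K * |t - s| := by
  rw [primitive_sub_primitive hC]
  exact intervalIntegral.norm_integral_le_of_norm_le_const (f := C) fun u _ => hK u

theorem primitive_neg (heven : ∀ t, C (-t) = C t) (t : ℝ) : primitive C (-t) = -primitive C t := by
  have h := intervalIntegral.integral_comp_neg (a := 0) (b := t) C
  simp only [heven, neg_zero] at h
  rw [primitive, primitive, h, intervalIntegral.integral_symm]

theorem squareIntegral_eq (hC : Continuous C) (heven : ∀ t, C (-t) = C t) (T : ℝ) :
    squareIntegral C T = 2 * primitive (primitive C) T := by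
  have hF := continuous_primitive hC
  have hinner (s : ℝ) : ∫ s' in (0 : ℝ)..T, C (s' - s) = primitive C (T - s) + primitive C s := by
    rw [intervalIntegral.integral_comp_sub_right C s, zero_sub, ← primitive_sub_primitive hC,
      primitive_neg heven, sub_neg_eq_add]
  have hrev : ∫ s in (0 : ℝ)..T, primitive C (T - s) = primitive (primitive C) T := by
    rw [intervalIntegral.integral_comp_sub_left (primitive C) T, sub_self, sub_zero, primitive]
  have hadd : ∫ s in (0 : ℝ)..T, (primitive C (T - s) + primitive C s) =
      (∫ s in (0 : ℝ)..T, primitive C (T - s)) + primitive (primitive C) T :=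
    intervalIntegral.integral_add ((hF.comp (continuous_const.sub continuous_id)).intervalIntegrable
      _ _) (hF.intervalIntegrable _ _)
  simp only [squareIntegral, hinner]
  rw [hadd, hrev, two_mul]

theorem squareIntegral_sub_squareIntegral (hC : Continuous C) (heven : ∀ t, C (-t) = C t)
    (S T : ℝ) : squareIntegral C T - squareIntegral C S = 2 * ∫ s in S..T, primitive C s := by
  rw [squareIntegral_eq hC heven, squareIntegral_eq hC heven, ← mul_sub,
    primitive_sub_primitive (continuous_primitive hC)]

theorem abs_squareIntegral_sub_le (hC : Continuous C) (heven : ∀ t, C (-t) = C t)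
    (hK : ∀ t, |C t| ≤ K) {S T : ℝ} (hS : 0 ≤ S) (hST : S ≤ T) :
    |squareIntegral C T - squareIntegral C S| ≤ 2 * (K * T * (T - S)) := by
  have hK0 : 0 ≤ K := (abs_nonneg _).trans (hK 0)
  have hbound : |∫ s in S..T, primitive C s| ≤ K * T * |T - S| := by
    refine intervalIntegral.norm_integral_le_of_norm_le_const (f := primitive C) fun u hu => ?_
    rw [Set.uIoc_of_le hST] at hu
    have h := abs_primitive_sub_le hC hK 0 u
    rw [primitive_zero, sub_zero, sub_zero, abs_of_nonneg (hS.trans hu.1.le)] at h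
    exact h.trans (mul_le_mul_of_nonneg_left hu.2 hK0)
  rw [abs_of_nonneg (sub_nonneg.2 hST)] at hbound
  rw [squareIntegral_sub_squareIntegral hC heven, abs_mul, abs_two]
  gcongr

theorem abs_squareIntegral_sub_sub_le (hC : Continuous C) (heven : ∀ t, C (-t) = C t)
    (hK : ∀ t, |C t| ≤ K) {S T : ℝ} (hST : S ≤ T) :
    |squareIntegral C T - squareIntegral C S - 2 * ((T - S) * primitive C S)| ≤
      2 * (K * (T - S) ^ 2) := by
  have hK0 : 0 ≤ K := (abs_nonneg _).trans (hK 0)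
  have hint : ∫ u in S..T, (primitive C u - primitive C S) =
      (∫ u in S..T, primitive C u) - (T - S) * primitive C S := by
    rw [intervalIntegral.integral_sub ((continuous_primitive hC).intervalIntegrable _ _)
      (continuous_const.intervalIntegrable _ _), intervalIntegral.integral_const, smul_eq_mul]
  have hbound : |∫ u in S..T, (primitive C u - primitive C S)| ≤ K * (T - S) * |T - S| := by
    refine intervalIntegral.norm_integral_le_of_norm_le_const
      (f := fun u => primitive C u - primitive C S) fun u hu => ?_
    rw [Set.uIoc_of_le hST] at hu
    refine (abs_primitive_sub_le hC hK S u).trans (mul_le_mul_of_nonneg_left ?_ hK0)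
    rw [abs_of_pos (sub_pos.2 hu.1)]
    exact sub_le_sub_right hu.2 S
  rw [abs_of_nonneg (sub_nonneg.2 hST), hint] at hbound
  rw [squareIntegral_sub_squareIntegral hC heven, ← mul_sub, abs_mul, abs_two, sq, ← mul_assoc K]
  gcongr

theorem tendsto_squareIntegral_of_dominated {F : ℕ → ℝ → ℝ} (hF : ∀ n, Continuous (F n))
    (hK : ∀ n t, |F n t| ≤ K) (hlim : ∀ t, Tendsto (fun n => F n t) atTop (𝓝 (C t))) (T : ℝ) :
    Tendsto (fun n => squareIntegral (F n) T) atTop (𝓝 (squareIntegral C T)) := by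
  have hinner (s : ℝ) : Tendsto (fun n => ∫ s' in (0 : ℝ)..T, F n (s' - s)) atTop
      (𝓝 (∫ s' in (0 : ℝ)..T, C (s' - s))) := by
    refine intervalIntegral.tendsto_integral_filter_of_dominated_convergence (fun _ => K)
      (.of_forall fun n => ?_) (.of_forall fun n => ae_of_all _ fun s' _ => hK n _)
      intervalIntegrable_const (ae_of_all _ fun s' _ => hlim _)
    exact ((hF n).comp (continuous_id.sub continuous_const)).aestronglyMeasurable
  refine intervalIntegral.tendsto_integral_filter_of_dominated_convergence (fun _ => K * |T - 0|)
    (.of_forall fun n => ?_) (.of_forall fun n => ae_of_all _ fun s _ => ?_)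
    intervalIntegrable_const (ae_of_all _ fun s _ => hinner s)
  · refine (intervalIntegral.continuous_parametric_intervalIntegral_of_continuous' ?_ 0
      T).aestronglyMeasurable
    exact (hF n).comp (continuous_snd.sub continuous_fst)
  · exact intervalIntegral.norm_integral_le_of_norm_le_const fun s' _ => hK n _

/-- Fekete's lemma gives the limit along the integers; the Lipschitz bound on `primitive C` extends
it to real times. -/
theorem exists_tendsto_squareIntegral_div_sq (hC : Continuous C) (heven : ∀ t, C (-t) = C t)
    (hK : ∀ t, |C t| ≤ K) (hpos : ∀ T, 0 ≤ squareIntegral C T)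
    (hsub : ∀ S T,
      √(squareIntegral C (S + T)) ≤ √(squareIntegral C S) + √(squareIntegral C T)) :
    ∃ D, Tendsto (fun T => squareIntegral C T / T ^ 2) atTop (𝓝 D) := by
  have hfekete : Subadditive fun n : ℕ => √(squareIntegral C n) := fun m n =>
    mod_cast hsub m n
  have hlim := hfekete.tendsto_lim ⟨0, by rintro _ ⟨n, rfl⟩; positivity⟩
  have hfloor : Tendsto (fun T : ℝ => squareIntegral C ⌊T⌋₊ / T ^ 2) atTop
      (𝓝 (hfekete.lim ^ 2)) := by
    have h := ((hlim.comp tendsto_nat_floor_atTop).pow 2).mul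
      ((tendsto_nat_floor_div_atTop (R := ℝ)).pow 2)
    rw [one_pow, mul_one] at h
    refine h.congr' ?_
    filter_upwards [eventually_ge_atTop 1] with T hT
    have hfloor0 : (⌊T⌋₊ : ℝ) ≠ 0 := mod_cast (Nat.floor_pos.2 hT).ne'
    rw [Function.comp_apply, div_pow, Real.sq_sqrt (hpos _)]
    field_simp
  have hdiff : Tendsto (fun T : ℝ => squareIntegral C T / T ^ 2 - squareIntegral C ⌊T⌋₊ / T ^ 2)
      atTop (𝓝 0) := by
    refine squeeze_zero_norm' (a := fun T : ℝ => 2 * K / T) ?_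
      (tendsto_const_nhds.div_atTop tendsto_id)
    filter_upwards [eventually_gt_atTop 0] with T hT
    have hK0 : 0 ≤ K := (abs_nonneg _).trans (hK 0)
    have hgap : T - ⌊T⌋₊ ≤ 1 := by linarith [Nat.lt_floor_add_one T]
    have h := abs_squareIntegral_sub_le hC heven hK (Nat.cast_nonneg _) (Nat.floor_le hT.le)
    rw [← sub_div, Real.norm_eq_abs, abs_div, abs_of_pos (sq_pos_of_pos hT)]
    calc |squareIntegral C T - squareIntegral C ⌊T⌋₊| / T ^ 2
        ≤ 2 * (K * T * 1) / T ^ 2 := by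
          refine div_le_div_of_nonneg_right (h.trans ?_) (sq_nonneg T)
          gcongr
      _ = 2 * K / T := by field_simp
  exact ⟨_, by simpa only [sub_add_cancel, zero_add] using hdiff.add hfloor⟩

theorem tendsto_squareIntegral_diffQuot {D : ℝ}
    (hD : Tendsto (fun T => squareIntegral C T / T ^ 2) atTop (𝓝 D)) {ε : ℝ} (hε : 0 < ε) :
    Tendsto (fun T => (squareIntegral C ((1 + ε) * T) - squareIntegral C T) / (2 * ε * T ^ 2))
      atTop (𝓝 (D * (1 + ε / 2))) := by
  have hscaled : Tendsto (fun T => squareIntegral C ((1 + ε) * T) / ((1 + ε) * T) ^ 2) atTop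
      (𝓝 D) := hD.comp (tendsto_id.const_mul_atTop (by positivity))
  have h := ((hscaled.mul_const ((1 + ε) ^ 2)).sub hD).div_const (2 * ε)
  have hval : (D * (1 + ε) ^ 2 - D) / (2 * ε) = D * (1 + ε / 2) := by
    field_simp
    ring
  rw [hval] at h
  refine h.congr' ?_
  filter_upwards [eventually_gt_atTop 0] with T hT
  have : 1 + ε ≠ 0 := by positivity
  field_simp

theorem abs_squareIntegral_diffQuot_sub_le (hC : Continuous C) (heven : ∀ t, C (-t) = C t)
    (hK : ∀ t, |C t| ≤ K) {ε T : ℝ} (hε : 0 < ε) (hT : 0 < T) :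
    |(squareIntegral C ((1 + ε) * T) - squareIntegral C T) / (2 * ε * T ^ 2) -
      primitive C T / T| ≤ K * ε := by
  have h := abs_squareIntegral_sub_sub_le hC heven hK (S := T) (T := (1 + ε) * T) (by nlinarith)
  have heq : (squareIntegral C ((1 + ε) * T) - squareIntegral C T) / (2 * ε * T ^ 2) -
      primitive C T / T = (squareIntegral C ((1 + ε) * T) - squareIntegral C T -
        2 * (((1 + ε) * T - T) * primitive C T)) / (2 * ε * T ^ 2) := by
    field_simp
    ring
  rw [heq, abs_div, abs_of_pos (by positivity : 0 < 2 * ε * T ^ 2), div_le_iff₀ (by positivity)]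
  exact h.trans_eq (by ring)

/-- A Tauberian step: since `primitive C` is Lipschitz, its value at `T` is close to its mean over
`[T, (1 + ε) * T]`, a difference quotient of `squareIntegral C`. -/
theorem tendsto_primitive_div (hC : Continuous C) (heven : ∀ t, C (-t) = C t) {D : ℝ}
    (hK : ∀ t, |C t| ≤ K) (hD : Tendsto (fun T => squareIntegral C T / T ^ 2) atTop (𝓝 D)) :
    Tendsto (fun T => primitive C T / T) atTop (𝓝 D) := by
  have hK0 : 0 ≤ K := (abs_nonneg _).trans (hK 0)
  rw [Metric.tendsto_nhds]
  intro δ hδ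
  obtain ⟨ε, hε, hεδ⟩ : ∃ ε > 0, (K + |D| / 2 + 1) * ε < δ := by
    refine ⟨δ / 2 / (K + |D| / 2 + 1), by positivity, ?_⟩
    rw [mul_div_cancel₀ _ (by positivity)]
    exact half_lt_self hδ
  filter_upwards [Metric.tendsto_nhds.1 (tendsto_squareIntegral_diffQuot hD hε) ε hε,
    eventually_gt_atTop 0] with T hquot hT
  have hclose := abs_squareIntegral_diffQuot_sub_le hC heven hK hε hT
  have hlimit : |D * (1 + ε / 2) - D| = |D| / 2 * ε := by
    rw [show D * (1 + ε / 2) - D = D * (ε / 2) by ring, abs_mul, abs_of_pos (half_pos hε)]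
    ring
  rw [← Real.dist_eq] at hclose hlimit
  rw [dist_comm] at hclose
  calc dist (primitive C T / T) D ≤ K * ε + ε + |D| / 2 * ε :=
        (dist_triangle4 _ _ _ _).trans (add_le_add (add_le_add hclose hquot.le) hlimit.le)
    _ = (K + |D| / 2 + 1) * ε := by ring
    _ < δ := hεδ

end TimeAverage

section Autocorrelation

variable {A : Type*} [CStarAlgebra A]

/-- The autocorrelation `φ(a τ_t(a))` of `a` under the dynamics generated by `H`. Taking the real
part loses nothing for self-adjoint `a`, see `IsTracialState.apply_mul_heisenberg_eq_autocorr`. -/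
def autocorr (φ : A →L[ℂ] ℂ) (H : selfAdjoint A) (a : A) (t : ℝ) : ℝ :=
  (φ (a * heisenberg H t a)).re

theorem continuous_autocorr (φ : A →L[ℂ] ℂ) (H : selfAdjoint A) (a : A) :
    Continuous (autocorr φ H a) :=
  Complex.continuous_re.comp <|
    φ.continuous.comp (continuous_const.mul (continuous_heisenberg_time H a))

theorem map_timeIntegral_mul (φ : A →L[ℂ] ℂ) (H : selfAdjoint A) (a b : A) (T : ℝ) :
    φ (timeIntegral H a T * b) = ∫ s in (0 : ℝ)..T, φ (heisenberg H s a * b) :=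
  map_timeIntegral (φ.comp ((ContinuousLinearMap.mul ℂ A).flip b)) H a T

theorem map_mul_timeIntegral (φ : A →L[ℂ] ℂ) (H : selfAdjoint A) (a b : A) (T : ℝ) :
    φ (b * timeIntegral H a T) = ∫ s in (0 : ℝ)..T, φ (b * heisenberg H s a) :=
  map_timeIntegral (φ.comp (ContinuousLinearMap.mul ℂ A b)) H a T

namespace IsTracialState

variable {φ : A →L[ℂ] ℂ} (hφ : IsTracialState φ) (H : selfAdjoint A)
include hφ

theorem apply_heisenberg (a : A) (t : ℝ) : φ (heisenberg H t a) = φ a := by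
  rw [heisenberg, Unitary.conjStarAlgAut_apply, hφ.mul_comm, ← mul_assoc, Unitary.coe_star_mul_self,
    one_mul]

theorem apply_heisenberg_mul_heisenberg (a b : A) (s t : ℝ) :
    φ (heisenberg H s a * heisenberg H t b) = φ (a * heisenberg H (t - s) b) := by
  rw [← hφ.apply_heisenberg H (a * heisenberg H (t - s) b) s, map_mul (heisenberg H s),
    ← heisenberg_add, add_sub_cancel]

theorem hsNorm_heisenberg (a : A) (t : ℝ) : hsNorm φ (heisenberg H t a) = hsNorm φ a := by
  rw [hsNorm, ← StarHomClass.map_star (heisenberg H t), ← map_mul (heisenberg H t),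
    hφ.apply_heisenberg, hsNorm]

theorem autocorr_neg (a : A) (t : ℝ) : autocorr φ H a (-t) = autocorr φ H a t := by
  have h := hφ.apply_heisenberg_mul_heisenberg H a a t 0
  rw [heisenberg_zero_time, zero_sub, hφ.mul_comm] at h
  rw [autocorr, autocorr, h]

variable {a : A} (ha : IsSelfAdjoint a)
include ha

theorem apply_mul_heisenberg_eq_autocorr (t : ℝ) :
    φ (a * heisenberg H t a) = autocorr φ H a t :=
  (Complex.conj_eq_iff_re.1 (Complex.conj_eq_iff_im.2
    (hφ.im_apply_mul_eq_zero ha (ha.map (heisenberg H t))))).symm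

theorem abs_autocorr_le (t : ℝ) : |autocorr φ H a t| ≤ autocorr φ H a 0 := by
  have h := (Complex.abs_re_le_norm _).trans (hφ.norm_apply_star_mul_le a (heisenberg H t a))
  rw [hφ.hsNorm_heisenberg, ← sq, hφ.hsNorm_sq, ha.star_eq] at h
  simpa only [autocorr, heisenberg_zero_time] using h

theorem hsNorm_timeIntegral_sq (T : ℝ) :
    hsNorm φ (timeIntegral H a T) ^ 2 = squareIntegral (autocorr φ H a) T := by
  rw [hφ.hsNorm_sq, (isSelfAdjoint_timeIntegral H ha T).star_eq, map_timeIntegral_mul]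
  simp only [map_mul_timeIntegral, hφ.apply_heisenberg_mul_heisenberg,
    hφ.apply_mul_heisenberg_eq_autocorr H ha, intervalIntegral.integral_ofReal, Complex.ofReal_re]
  rfl

omit ha

theorem hsNorm_timeIntegral_add_le (a : A) (S T : ℝ) :
    hsNorm φ (timeIntegral H a (S + T)) ≤
      hsNorm φ (timeIntegral H a S) + hsNorm φ (timeIntegral H a T) := by
  rw [timeIntegral_add, ← hφ.hsNorm_heisenberg H (timeIntegral H a T) S]
  exact hφ.hsNorm_add_le _ _

end IsTracialState

end Autocorrelation

section CurrentCorrelation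

theorem tendsto_pairAverage_of_unique {ℓ : ℕ} {c : ℕ → ℤ → ℤ → ℂ} {w : ℤ → ℂ} {g : ℤ → ℝ}
    (hg : Summable g) (hc : ∀ n x y, ‖c n x y‖ ≤ g (x - y))
    (hbulk : ∀ z, ∀ ε > 0, ∃ r : ℕ, ∀ (n : ℕ) (y : ℤ), r ≤ y → y ≤ n - r →
      ‖c n (y + z) y - w z‖ ≤ ε) :
    Tendsto (fun n : ℕ => 1 / (n : ℂ) * ∑ x ∈ Finset.Icc (1 : ℤ) (n - ℓ + 1),
      ∑ y ∈ Finset.Icc (1 : ℤ) (n - ℓ + 1), c n x y) atTop (𝓝 (∑' z, w z)) := by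
  have h := tendsto_pairAverage (ι := Unit) (ℓ := fun _ => ℓ) (ℓ' := fun _ => ℓ)
    (s := fun _ => Finset.univ) (by simp) (c := fun n _ => c n) (w := fun p => w p.2)
    (g := fun p => g p.2) ((Equiv.punitProd ℤ).summable_iff.2 hg) (fun n _ => hc n)
    (fun _ => hbulk)
  have htsum : ∑' p : Unit × ℤ, w p.2 = ∑' z, w z := (Equiv.punitProd ℤ).tsum_eq w
  rw [htsum] at h
  simpa using h

variable {N dh dj : ℕ} {h : LocalMatrix N dh} {j : LocalMatrix N dj}

/-- The sum of the translates of the `d`-site matrix `M` over the windows contained in the chain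
`[1, n]`, as an element of the quasi-local algebra. -/
def chainSum {d : ℕ} (M : LocalMatrix N d) (n : ℕ) : QuasiLocal N :=
  ∑ x ∈ Finset.Icc (1 : ℤ) (n - d + 1), observable x M

theorem coe_chainSum {d : ℕ} (M : LocalMatrix N d) (n : ℕ) :
    (chainSum M n : Op N) = homogeneousSum M 1 n :=
  map_sum (quasiLocalAlgebra N).subtype _ _

theorem isSelfAdjoint_chainSum {d : ℕ} {M : LocalMatrix N d} (hM : M.IsHermitian) (n : ℕ) :
    IsSelfAdjoint (chainSum M n) :=
  isSelfAdjoint_sum _ fun x _ => isSelfAdjoint_observable x hM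

/-- The Hamiltonian of the chain `[1, n]`. -/
abbrev chainHamiltonian (hh : h.IsHermitian) (n : ℕ) : selfAdjoint (QuasiLocal N) :=
  hamiltonian (interaction hh) (Finset.Icc 1 (n - dh + 1))

theorem coe_chainHamiltonian (hh : h.IsHermitian) (n : ℕ) :
    (chainHamiltonian hh n : QuasiLocal N) = chainSum h n := by
  rw [chainHamiltonian, coe_hamiltonian]
  rfl

variable [NeZero N]

/-- The sum `∑ₓ ω(j_x τ_t(j_0))` of the correlations of a current density over all sites. -/
def currentCorr (hh : h.IsHermitian) (j : LocalMatrix N dj) (t : ℝ) : ℂ :=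
  ∑' z : ℤ, trace N (observable z j * flow hh t (observable 0 j))

theorem exists_norm_trace_mul_flow_zero_le (hh : h.IsHermitian) (hj0 : trace N (observable 0 j) = 0)
    (T : ℝ) : ∃ C, ∀ (z : ℤ) {t : ℝ}, |t| ≤ T →
      ‖trace N (observable z j * flow hh t (observable 0 j))‖ ≤ C * Real.exp (-(|z| : ℤ)) := by
  obtain ⟨C, hC⟩ := exists_norm_trace_mul_flow_le hh j hj0 T
  exact ⟨C, fun z t ht => by simpa only [sub_zero] using hC z 0 ht⟩

theorem hasSum_currentCorr (hh : h.IsHermitian) (hj0 : trace N (observable 0 j) = 0) (t : ℝ) :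
    HasSum (fun z : ℤ => trace N (observable z j * flow hh t (observable 0 j)))
      (currentCorr hh j t) := by
  obtain ⟨C, hC⟩ := exists_norm_trace_mul_flow_zero_le hh hj0 |t|
  exact (Summable.of_norm_bounded (summable_exp_neg_abs.mul_left C) fun z => hC z le_rfl).hasSum

theorem continuous_currentCorr (hh : h.IsHermitian) (hj0 : trace N (observable 0 j) = 0) :
    Continuous (currentCorr hh j) := by
  refine continuous_iff_continuousAt.2 fun t => ?_
  obtain ⟨C, hC⟩ := exists_norm_trace_mul_flow_zero_le hh hj0 (|t| + 1)
  have hcont (z : ℤ) :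
      Continuous fun t => trace N (observable z j * flow hh t (observable 0 j)) :=
    (trace N).continuous.comp (continuous_const.mul (continuous_flow_observable hh j 0))
  refine (continuousOn_tsum (s := Set.Icc (-(|t| + 1)) (|t| + 1)) (fun z => (hcont z).continuousOn)
    (summable_exp_neg_abs.mul_left C) fun z s hs => hC z (abs_le.2 hs)).continuousAt
    (Icc_mem_nhds ?_ ?_)
  · linarith [neg_abs_le t]
  · linarith [le_abs_self t]

theorem tendsto_flow_chainSum (hh : h.IsHermitian) (hj0 : trace N (observable 0 j) = 0) (t : ℝ) :
    Tendsto (fun n : ℕ => 1 / (n : ℂ) * trace N (chainSum j n * flow hh t (chainSum j n))) atTop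
      (𝓝 (currentCorr hh j t)) := by
  obtain ⟨C, hC⟩ := exists_norm_trace_mul_flow_le hh j hj0 |t|
  refine (tendsto_pairAverage_of_unique (ℓ := dj)
    (c := fun _ x y => trace N (observable x j * flow hh t (observable y j)))
    (summable_exp_neg_abs.mul_left C) (fun _ x y => hC x y le_rfl)
    fun z ε hε => ⟨0, fun n y _ _ => ?_⟩).congr fun n => ?_
  · have h := trace_observable_add_mul_flow hh j j z 0 y t
    rw [zero_add, add_comm z y] at h
    rw [h, sub_self, norm_zero]
    exact hε.le
  · simp only [chainSum, map_sum, Finset.sum_mul_sum]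

/-- In the bulk of a long chain the finite-volume evolution of a local observable agrees with the
infinite-volume one up to an exponentially small error, so both give the same limit. -/
theorem tendsto_heisenberg_chainSum (hh : h.IsHermitian) (hj0 : trace N (observable 0 j) = 0)
    (t : ℝ) :
    Tendsto (fun n : ℕ => 1 / (n : ℂ) * trace N
      (chainSum j n * heisenberg (chainHamiltonian hh n) t (chainSum j n))) atTop
      (𝓝 (currentCorr hh j t)) := by
  obtain ⟨C, hC⟩ := exists_norm_trace_mul_finiteFlow_le hh j hj0 |t|
  obtain ⟨B, hB⟩ := exists_norm_flow_sub_finiteFlow_le hh j |t|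
  let m := ‖observable (N := N) 0 j‖
  refine (tendsto_pairAverage_of_unique (ℓ := dj) (c := fun n x y => trace N
      (observable x j * heisenberg (chainHamiltonian hh n) t (observable y j)))
    (summable_exp_neg_abs.mul_left C) (fun n x y => hC x y _ le_rfl)
    fun z ε hε => ?_).congr fun n => ?_
  · obtain ⟨r, hr⟩ := exists_const_mul_exp_neg_lt (m * B) hε
    refine ⟨r + dh + dj, fun n y hy hyn => ?_⟩
    have hinv := trace_observable_add_mul_flow hh j j z 0 y t
    rw [zero_add, add_comm z y] at hinv
    have happrox := hB y r (S := Finset.Icc 1 (n - dh + 1)) (fun x hx hx' => by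
      rw [Finset.mem_Icc]
      push_cast at hy hyn
      omega) (le_refl |t|)
    rw [← hinv, norm_sub_rev, ← map_sub, ← mul_sub]
    calc _ ≤ ‖observable (N := N) (y + z) j‖ * _ :=
          (isTracialState_trace.norm_le _).trans (norm_mul_le _ _)
      _ ≤ m * (B * Real.exp (-r)) := by
          rw [norm_observable]
          gcongr
      _ ≤ ε := by rw [← mul_assoc]; exact hr.le
  · simp only [chainSum, map_sum, Finset.sum_mul_sum]

/-- The autocorrelation per site of the current of the chain `[1, n]`. -/
def chainCorr (hh : h.IsHermitian) (j : LocalMatrix N dj) (n : ℕ) (t : ℝ) : ℝ :=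
  1 / n * autocorr (trace N) (chainHamiltonian hh n) (chainSum j n) t

theorem ofReal_chainCorr (hh : h.IsHermitian) (hj : j.IsHermitian) (n : ℕ) (t : ℝ) :
    (chainCorr hh j n t : ℂ) = 1 / (n : ℂ) * trace N
      (chainSum j n * heisenberg (chainHamiltonian hh n) t (chainSum j n)) := by
  rw [isTracialState_trace.apply_mul_heisenberg_eq_autocorr _ (isSelfAdjoint_chainSum hj n),
    chainCorr]
  push_cast
  rfl

theorem tendsto_ofReal_chainCorr (hh : h.IsHermitian) (hj : j.IsHermitian)
    (hj0 : trace N (observable 0 j) = 0) (t : ℝ) :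
    Tendsto (fun n => (chainCorr hh j n t : ℂ)) atTop (𝓝 (currentCorr hh j t)) := by
  simpa only [ofReal_chainCorr hh hj] using tendsto_heisenberg_chainSum hh hj0 t

theorem tendsto_chainCorr (hh : h.IsHermitian) (hj : j.IsHermitian)
    (hj0 : trace N (observable 0 j) = 0) (t : ℝ) :
    Tendsto (fun n => chainCorr hh j n t) atTop (𝓝 (currentCorr hh j t).re) :=
  (Complex.continuous_re.tendsto _).comp (tendsto_ofReal_chainCorr hh hj hj0 t)

theorem ofReal_re_currentCorr (hh : h.IsHermitian) (hj : j.IsHermitian)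
    (hj0 : trace N (observable 0 j) = 0) (t : ℝ) :
    ((currentCorr hh j t).re : ℂ) = currentCorr hh j t :=
  tendsto_nhds_unique ((Complex.continuous_ofReal.tendsto _).comp (tendsto_chainCorr hh hj hj0 t))
    (tendsto_ofReal_chainCorr hh hj hj0 t)

theorem continuous_chainCorr (hh : h.IsHermitian) (j : LocalMatrix N dj) (n : ℕ) :
    Continuous (chainCorr hh j n) :=
  continuous_const.mul (continuous_autocorr _ _ _)

theorem exists_abs_chainCorr_le (hh : h.IsHermitian) (hj : j.IsHermitian)
    (hj0 : trace N (observable 0 j) = 0) : ∃ K, ∀ n t, |chainCorr hh j n t| ≤ K := by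
  obtain ⟨K, hK⟩ := (tendsto_chainCorr hh hj hj0 0).bddAbove_range
  refine ⟨K, fun n t => le_trans ?_ (hK ⟨n, rfl⟩)⟩
  rw [chainCorr, abs_mul, abs_of_nonneg (by positivity : (0 : ℝ) ≤ 1 / n)]
  exact mul_le_mul_of_nonneg_left
    (isTracialState_trace.abs_autocorr_le _ (isSelfAdjoint_chainSum hj n) t) (by positivity)

theorem squareIntegral_chainCorr (hh : h.IsHermitian) (hj : j.IsHermitian) (n : ℕ) (T : ℝ) :
    squareIntegral (chainCorr hh j n) T =
      hsNorm (trace N) (timeIntegral (chainHamiltonian hh n) (chainSum j n) T) ^ 2 / n := by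
  rw [isTracialState_trace.hsNorm_timeIntegral_sq _ (isSelfAdjoint_chainSum hj n)]
  simp only [squareIntegral, chainCorr, intervalIntegral.integral_const_mul]
  ring

theorem tendsto_squareIntegral_chainCorr (hh : h.IsHermitian) (hj : j.IsHermitian)
    (hj0 : trace N (observable 0 j) = 0) (T : ℝ) :
    Tendsto (fun n => squareIntegral (chainCorr hh j n) T) atTop
      (𝓝 (squareIntegral (fun t => (currentCorr hh j t).re) T)) := by
  obtain ⟨K, hK⟩ := exists_abs_chainCorr_le hh hj hj0
  exact tendsto_squareIntegral_of_dominated (continuous_chainCorr hh j) hK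
    (tendsto_chainCorr hh hj hj0) T

theorem tendsto_hsNorm_timeIntegral (hh : h.IsHermitian) (hj : j.IsHermitian)
    (hj0 : trace N (observable 0 j) = 0) (T : ℝ) :
    Tendsto (fun n : ℕ =>
      hsNorm (trace N) (timeIntegral (chainHamiltonian hh n) (chainSum j n) T) / √n) atTop
      (𝓝 √(squareIntegral (fun t => (currentCorr hh j t).re) T)) := by
  refine ((Real.continuous_sqrt.tendsto _).comp
    (tendsto_squareIntegral_chainCorr hh hj hj0 T)).congr fun n => ?_
  rw [Function.comp_apply, squareIntegral_chainCorr hh hj, Real.sqrt_div (sq_nonneg _),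
    Real.sqrt_sq (hsNorm_nonneg _ _)]

theorem exists_tendsto_timeAverage_currentCorr (hh : h.IsHermitian) (hj : j.IsHermitian)
    (hj0 : trace N (observable 0 j) = 0) :
    ∃ D, Tendsto (fun T => squareIntegral (fun t => (currentCorr hh j t).re) T / T ^ 2) atTop
        (𝓝 D) ∧
      Tendsto (fun T => primitive (fun t => (currentCorr hh j t).re) T / T) atTop (𝓝 D) := by
  set C : ℝ → ℝ := fun t => (currentCorr hh j t).re
  have hlim := tendsto_chainCorr hh hj hj0
  have hcont : Continuous C := Complex.continuous_re.comp (continuous_currentCorr hh hj0)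
  have heven (t : ℝ) : C (-t) = C t := tendsto_nhds_unique (hlim (-t)) <| by
    simpa only [chainCorr, isTracialState_trace.autocorr_neg] using hlim t
  obtain ⟨K, hK⟩ := exists_abs_chainCorr_le hh hj hj0
  have hbound (t : ℝ) : |C t| ≤ K := le_of_tendsto' (hlim t).abs fun n => hK n t
  have hpos (T : ℝ) : 0 ≤ squareIntegral C T :=
    ge_of_tendsto' (tendsto_squareIntegral_chainCorr hh hj hj0 T) fun n => by
      rw [squareIntegral_chainCorr hh hj]
      positivity
  have hsub (S T : ℝ) :
      √(squareIntegral C (S + T)) ≤ √(squareIntegral C S) + √(squareIntegral C T) := by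
    refine le_of_tendsto_of_tendsto' (tendsto_hsNorm_timeIntegral hh hj hj0 (S + T))
      ((tendsto_hsNorm_timeIntegral hh hj hj0 S).add (tendsto_hsNorm_timeIntegral hh hj hj0 T))
      fun n => ?_
    rw [← add_div]
    exact div_le_div_of_nonneg_right
      (isTracialState_trace.hsNorm_timeIntegral_add_le _ _ S T) (Real.sqrt_nonneg _)
  obtain ⟨D, hD⟩ := exists_tendsto_squareIntegral_div_sq hcont heven hbound hpos hsub
  exact ⟨D, hD, tendsto_primitive_div hcont heven hbound hD⟩

end CurrentCorrelation

section Overlap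

variable {A : Type*} [CStarAlgebra A] {φ : A →L[ℂ] ℂ}

namespace IsTracialState

variable (hφ : IsTracialState φ)
include hφ

theorem norm_apply_mul_lie_le (h a b : A) : ‖φ (a * ⁅h, b⁆)‖ ≤ ‖⁅h, a⁆‖ * hsNorm φ b := by
  rw [← norm_neg, ← hφ.apply_lie_mul]
  exact (hφ.norm_apply_mul_le _ _).trans
    (mul_le_mul_of_nonneg_right (hφ.hsNorm_le_norm _) (hsNorm_nonneg φ b))

theorem hasDerivAt_apply_heisenberg_mul (H : selfAdjoint A) (a b : A) (t : ℝ) :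
    HasDerivAt (fun s => φ (heisenberg H s a * b))
      (-(Complex.I * φ (heisenberg H t a * ⁅(H : A), b⁆))) t := by
  have h := ((φ.comp ((ContinuousLinearMap.mul ℂ A).flip b)).restrictScalars ℝ
    ).hasFDerivAt.comp_hasDerivAt t (hasDerivAt_heisenberg H a t)
  refine h.congr_deriv ?_
  change φ ((Complex.I • ⁅(H : A), heisenberg H t a⁆) * b) = _
  rw [smul_mul_assoc, map_smul, hφ.apply_lie_mul, smul_eq_mul, mul_neg]

/-- A charge `b` that is conserved up to `⁅H, b⁆` drifts out of correlation with the evolved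
observable at a rate given by the correlation of the latter with `⁅H, b⁆`. -/
theorem norm_apply_heisenberg_mul_sub_le {H : selfAdjoint A} {a b : A} {K T : ℝ}
    (hK : ∀ u ∈ Set.Icc 0 T, ‖φ (heisenberg H u a * ⁅(H : A), b⁆)‖ ≤ K) {s : ℝ}
    (hs : s ∈ Set.Icc 0 T) : ‖φ (heisenberg H s a * b) - φ (a * b)‖ ≤ K * s := by
  have h := norm_image_sub_le_of_norm_deriv_le_segment' (C := K)
    (fun u _ => (hφ.hasDerivAt_apply_heisenberg_mul H a b u).hasDerivWithinAt)
    (fun u hu => by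
      rw [norm_neg, norm_mul, Complex.norm_I, one_mul]
      exact hK u (Set.Ico_subset_Icc_self hu)) s hs
  simpa only [heisenberg_zero_time, sub_zero] using h

theorem norm_apply_timeIntegral_mul_sub_le {H : selfAdjoint A} {a b : A} {K T : ℝ} (hT : 0 ≤ T)
    (hK : ∀ u ∈ Set.Icc 0 T, ‖φ (heisenberg H u a * ⁅(H : A), b⁆)‖ ≤ K) :
    ‖φ (timeIntegral H a T * b) - T * φ (a * b)‖ ≤ K * T * T := by
  have hK0 : 0 ≤ K := (norm_nonneg _).trans (hK 0 (Set.left_mem_Icc.2 hT))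
  have hcont : Continuous fun s => φ (heisenberg H s a * b) := continuous_iff_continuousAt.2
    fun u => (hφ.hasDerivAt_apply_heisenberg_mul H a b u).continuousAt
  have hint : φ (timeIntegral H a T * b) - T * φ (a * b) =
      ∫ s in (0 : ℝ)..T, (φ (heisenberg H s a * b) - φ (a * b)) := by
    rw [intervalIntegral.integral_sub (hcont.intervalIntegrable _ _)
      (continuous_const.intervalIntegrable _ _), map_timeIntegral_mul,
      intervalIntegral.integral_const, sub_zero, Complex.real_smul]
  have hbound := intervalIntegral.norm_integral_le_of_norm_le_const (a := 0) (b := T) (C := K * T)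
    (f := fun s => φ (heisenberg H s a * b) - φ (a * b)) fun s hs => by
      rw [Set.uIoc_of_le hT] at hs
      exact (hφ.norm_apply_heisenberg_mul_sub_le hK ⟨hs.1.le, hs.2⟩).trans
        (mul_le_mul_of_nonneg_left hs.2 hK0)
  rwa [sub_zero, abs_of_nonneg hT, ← hint] at hbound

theorem mul_norm_apply_mul_le {H : selfAdjoint A} {a b : A} {K T : ℝ} (hT : 0 ≤ T)
    (hK : ∀ u ∈ Set.Icc 0 T, ‖φ (heisenberg H u a * ⁅(H : A), b⁆)‖ ≤ K) :
    T * ‖φ (a * b)‖ ≤ hsNorm φ (timeIntegral H a T) * hsNorm φ b + K * T * T := by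
  have herr := hφ.norm_apply_timeIntegral_mul_sub_le hT hK
  have hcs := hφ.norm_apply_mul_le (timeIntegral H a T) b
  have htri := norm_sub_norm_le (T * φ (a * b)) (φ (timeIntegral H a T * b))
  rw [norm_sub_rev, norm_mul, Complex.norm_of_nonneg hT] at htri
  linarith

end IsTracialState

end Overlap

section Mazur

variable {N dh dj db : ℕ} {h : LocalMatrix N dh} {j : LocalMatrix N dj} {b : LocalMatrix N db}

theorem coe_lie_chainHamiltonian (hh : h.IsHermitian) (n : ℕ) (A : QuasiLocal N) :
    ((⁅(chainHamiltonian hh n : QuasiLocal N), A⁆ : QuasiLocal N) : Op N) =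
      homogeneousSum h 1 n * A - A * homogeneousSum h 1 n := by
  rw [coe_chainHamiltonian, ← coe_chainSum]
  rfl

theorem exists_norm_lie_chainHamiltonian_le (hh : h.IsHermitian) (x : ℤ) (b : LocalMatrix N db) :
    ∃ K, 0 ≤ K ∧ ∀ n, ‖⁅(chainHamiltonian hh n : QuasiLocal N), observable x b⁆‖ ≤ K :=
  ⟨_, by positivity, fun _ => (isFiniteRange_interaction hh).norm_lie_hamiltonian_le
    (isLocalizedIn_observable hh x b) _⟩

variable [NeZero N]

open scoped ComplexOrder in
theorem hsNorm_observable_pos (hb : b ≠ 0) (x : ℤ) :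
    0 < hsNorm (trace N) (observable x b) := by
  refine (hsNorm_nonneg _ _).lt_of_ne' fun hzero => hb ?_
  have hre := isTracialState_trace.hsNorm_sq (observable x b)
  have him := isTracialState_trace.im_apply_eq_zero (IsSelfAdjoint.star_mul_self (observable x b))
  have htrace : trace N (star (observable x b) * observable x b) = 0 :=
    Complex.ext (by rw [← hre, hzero]; simp) him
  rw [← StarHomClass.map_star (observable x), ← map_mul (observable x), trace_observable,
    mul_eq_zero, or_iff_right (inv_ne_zero (pow_ne_zero _ (Nat.cast_ne_zero.2 (NeZero.ne N)))),
    Matrix.star_eq_conjTranspose, Matrix.trace_conjTranspose_mul_self_eq_zero_iff] at htrace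
  exact htrace

theorem exists_norm_trace_heisenberg_chainSum_mul_le (hh : h.IsHermitian) (j : LocalMatrix N dj)
    (hb0 : trace N (observable 0 b) = 0) (T : ℝ) :
    ∃ K, ∀ (n : ℕ) (w : ℤ) {t : ℝ}, |t| ≤ T →
      ‖trace N (heisenberg (chainHamiltonian hh n) t (chainSum j n) * observable w b)‖ ≤ K := by
  obtain ⟨C, hC⟩ := exists_norm_trace_mul_finiteFlow_le hh j hb0 T
  refine ⟨∑' z : ℤ, C * Real.exp (-(|z| : ℤ)), fun n w t ht => ?_⟩
  have hsum : Summable fun x : ℤ => C * Real.exp (-(|w - x| : ℤ)) :=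
    (Equiv.subLeft w).summable_iff.2 (summable_exp_neg_abs.mul_left C)
  rw [trace_mul_comm, chainSum, map_sum, Finset.mul_sum, map_sum,
    ← (Equiv.subLeft w).tsum_eq fun z : ℤ => C * Real.exp (-(|z| : ℤ))]
  exact (norm_sum_le_of_le _ fun x _ => hC w x _ ht).trans
    (hsum.sum_le_tsum _ fun x _ => (norm_nonneg _).trans (hC w x ∅ ht))

/-- The commutator with a charge that is small in Hilbert–Schmidt norm is small when tested against
the boundary term `b_1`, but its overlap with `b_1` is `ω(b* b)`, independently of the length. -/
theorem exists_hsNorm_lower_bound (hh : h.IsHermitian) (hb : b ≠ 0)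
    (hb0 : trace N (observable 0 b) = 0) {Q : ℕ → QuasiLocal N}
    (hcomm : ∀ n : ℕ, db ≤ n → ⁅(chainHamiltonian hh n : QuasiLocal N), Q n⁆ =
      observable 1 b - observable ((n : ℤ) - db + 1) b) :
    ∃ c > 0, ∀ n, 2 * db ≤ n → c ≤ hsNorm (trace N) (Q n) := by
  have hpos := hsNorm_observable_pos hb 1
  obtain ⟨K, hK0, hK⟩ := exists_norm_lie_chainHamiltonian_le hh 1 b.conjTranspose
  refine ⟨hsNorm (trace N) (observable 1 b) ^ 2 / (K + 1), by positivity, fun n hn => ?_⟩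
  have hfar : trace N (star (observable 1 b) * observable ((n : ℤ) - db + 1) b) = 0 := by
    rw [← StarHomClass.map_star (observable 1),
      trace_mul_observable_of_disjoint (Or.inl (by omega)), trace_observable ((n : ℤ) - db + 1),
      ← trace_observable 0, hb0, mul_zero]
  have hoverlap : trace N (star (observable 1 b) * ⁅(chainHamiltonian hh n : QuasiLocal N), Q n⁆) =
      trace N (star (observable 1 b) * observable 1 b) := by
    rw [hcomm n (by omega), mul_sub, map_sub, hfar, sub_zero]
  rw [div_le_iff₀ (by positivity)]
  calc hsNorm (trace N) (observable 1 b) ^ 2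
      ≤ ‖trace N (star (observable 1 b) * ⁅(chainHamiltonian hh n : QuasiLocal N), Q n⁆)‖ := by
        rw [isTracialState_trace.hsNorm_sq, hoverlap]
        exact Complex.re_le_norm _
    _ ≤ ‖⁅(chainHamiltonian hh n : QuasiLocal N), star (observable 1 b)⁆‖ *
          hsNorm (trace N) (Q n) := isTracialState_trace.norm_apply_mul_lie_le _ _ _
    _ ≤ K * hsNorm (trace N) (Q n) := by
        rw [← StarHomClass.map_star (observable 1)]
        exact mul_le_mul_of_nonneg_right (hK n) (hsNorm_nonneg _ _)
    _ ≤ hsNorm (trace N) (Q n) * (K + 1) := by linarith [hsNorm_nonneg (trace N) (Q n)]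

/-- A multiple of `1` cancels in `b_1 - b_{n - d_b + 1}`, so the boundary term may be taken
traceless. -/
theorem exists_traceless_boundary (hh : h.IsHermitian) {Q : ℕ → QuasiLocal N}
    (hQ : IsAlmostConserved h fun n => (Q n : Op N)) :
    ∃ (db : ℕ) (b : LocalMatrix N db), trace N (observable 0 b) = 0 ∧ ∀ n : ℕ, db ≤ n →
      ⁅(chainHamiltonian hh n : QuasiLocal N), Q n⁆ =
        observable 1 b - observable ((n : ℤ) - db + 1) b := by
  obtain ⟨db, b, hb⟩ := hQ
  have hcomm (n : ℕ) (hn : db ≤ n) : ⁅(chainHamiltonian hh n : QuasiLocal N), Q n⁆ =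
      observable 1 b - observable ((n : ℤ) - db + 1) b :=
    Subtype.ext ((coe_lie_chainHamiltonian hh n (Q n)).trans (hb n hn))
  have htrace_one : trace N 1 = 1 := by
    rw [← map_one (observable (N := N) (d := 0) 0), trace_observable]
    simp
  refine ⟨db, b - trace N (observable 0 b) • 1, ?_, fun n hn => ?_⟩
  · simp only [map_sub, map_smul, map_one, htrace_one, smul_eq_mul, mul_one, sub_self]
  · simp only [hcomm n hn, map_sub, map_smul, map_one, sub_sub_sub_cancel_right]

theorem exists_mazur_bound (hh : h.IsHermitian) (j : LocalMatrix N dj) {Q : ℕ → QuasiLocal N}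
    (hQ : IsAlmostConserved h fun n => (Q n : Op N)) {T : ℝ} (hT : 0 ≤ T) :
    ∃ K, ∀ᶠ n : ℕ in atTop, T * ‖trace N (chainSum j n * Q n)‖ ≤
      (hsNorm (trace N) (timeIntegral (chainHamiltonian hh n) (chainSum j n) T) + K) *
        hsNorm (trace N) (Q n) := by
  obtain ⟨db, b, hb0, hcomm⟩ := exists_traceless_boundary hh hQ
  rcases eq_or_ne b 0 with rfl | hb
  · refine ⟨0, (eventually_ge_atTop db).mono fun n hn => ?_⟩
    have h := isTracialState_trace.mul_norm_apply_mul_le (H := chainHamiltonian hh n)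
      (a := chainSum j n) (b := Q n) (K := 0) hT fun u _ => by simp [hcomm n hn]
    simpa using h
  · obtain ⟨c, hc, hcQ⟩ := exists_hsNorm_lower_bound hh hb hb0 hcomm
    obtain ⟨K, hK⟩ := exists_norm_trace_heisenberg_chainSum_mul_le hh j hb0 T
    have hK0 : 0 ≤ K := (norm_nonneg _).trans (hK 0 0 (t := 0) (by simpa using hT))
    refine ⟨(K + K) * T * T / c, (eventually_ge_atTop (2 * db)).mono fun n hn => ?_⟩
    have hlie := isTracialState_trace.mul_norm_apply_mul_le (H := chainHamiltonian hh n)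
      (a := chainSum j n) (b := Q n) (K := K + K) hT fun u hu => by
        have hu : |u| ≤ T := by rw [abs_of_nonneg hu.1]; exact hu.2
        rw [hcomm n (by omega), mul_sub, map_sub]
        exact (norm_sub_le _ _).trans (add_le_add (hK n _ hu) (hK n _ hu))
    have herr : (K + K) * T * T ≤ (K + K) * T * T / c * hsNorm (trace N) (Q n) := by
      rw [div_mul_eq_mul_div, le_div_iff₀ hc]
      exact mul_le_mul_of_nonneg_left (hcQ n hn) (by positivity)
    rw [add_mul]
    linarith

variable {Q : ℕ → QuasiLocal N} (hQsa : ∀ n, IsSelfAdjoint (Q n))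
include hQsa

theorem mazurRatio_eq (n : ℕ) :
    mazurRatio j (fun n => (Q n : Op N)) n =
      1 / n * ((trace N (chainSum j n * Q n)).re ^ 2 / hsNorm (trace N) (Q n) ^ 2) := by
  rw [isTracialState_trace.hsNorm_sq, (hQsa n).star_eq, trace_apply, trace_apply, mazurRatio,
    ← coe_chainSum]
  rfl

theorem mazurRatio_nonneg (n : ℕ) : 0 ≤ mazurRatio j (fun n => (Q n : Op N)) n := by
  rw [mazurRatio_eq hQsa]
  positivity

theorem mazurRatio_le_chainCorr (hh : h.IsHermitian) (hj : j.IsHermitian) (n : ℕ) :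
    mazurRatio j (fun n => (Q n : Op N)) n ≤ chainCorr hh j n 0 := by
  have hcs := (Complex.abs_re_le_norm _).trans
    (isTracialState_trace.norm_apply_mul_le (chainSum j n) (Q n))
  rw [mazurRatio_eq hQsa, chainCorr, autocorr, heisenberg_zero_time]
  gcongr
  have hnorm := isTracialState_trace.hsNorm_sq (chainSum j n)
  rw [(isSelfAdjoint_chainSum hj n).star_eq] at hnorm
  rw [← hnorm]
  refine div_le_of_le_mul₀ (sq_nonneg _) (sq_nonneg _) ?_
  rw [← mul_pow, ← sq_abs (Complex.re _)]
  gcongr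

theorem sq_mul_mazurRatio_le {n : ℕ} {T X K : ℝ} (hT : 0 ≤ T)
    (hle : T * ‖trace N (chainSum j n * Q n)‖ ≤ (X + K) * hsNorm (trace N) (Q n)) :
    T ^ 2 * mazurRatio j (fun n => (Q n : Op N)) n ≤ (X / √n + K / √n) ^ 2 := by
  rw [mazurRatio_eq hQsa, ← add_div, div_pow, Real.sq_sqrt (Nat.cast_nonneg n)]
  have hsq : T ^ 2 * (trace N (chainSum j n * Q n)).re ^ 2 ≤
      (X + K) ^ 2 * hsNorm (trace N) (Q n) ^ 2 := by
    rw [← mul_pow, ← mul_pow, ← sq_abs (T * _), abs_mul, abs_of_nonneg hT]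
    exact pow_le_pow_left₀ (by positivity)
      ((mul_le_mul_of_nonneg_left (Complex.abs_re_le_norm _) hT).trans hle) 2
  calc _ = 1 / n * (T ^ 2 * (trace N (chainSum j n * Q n)).re ^ 2 /
        hsNorm (trace N) (Q n) ^ 2) := by ring
    _ ≤ 1 / n * (X + K) ^ 2 := by
        gcongr
        exact div_le_of_le_mul₀ (sq_nonneg _) (sq_nonneg _) hsq
    _ = _ := by ring

variable (hh : h.IsHermitian) (hj : j.IsHermitian) (hj0 : trace N (observable 0 j) = 0)
include hj hj0

theorem bddAbove_mazurRatio : BddAbove (Set.range (mazurRatio j fun n => (Q n : Op N))) := by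
  have hzero : (0 : LocalMatrix N 0).IsHermitian := Matrix.isHermitian_zero
  obtain ⟨K, hK⟩ := exists_abs_chainCorr_le hzero hj hj0
  refine ⟨K, ?_⟩
  rintro _ ⟨n, rfl⟩
  exact (mazurRatio_le_chainCorr hQsa hzero hj n).trans ((le_abs_self _).trans (hK n 0))

include hh

theorem limsup_mazurRatio_le (hQ : IsAlmostConserved h fun n => (Q n : Op N)) {T : ℝ}
    (hT : 0 < T) :
    limsup (mazurRatio j fun n => (Q n : Op N)) atTop ≤
      squareIntegral (fun t => (currentCorr hh j t).re) T / T ^ 2 := by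
  obtain ⟨K, hK⟩ := exists_mazur_bound hh j hQ hT.le
  have hcob : IsCoboundedUnder (· ≤ ·) atTop (mazurRatio j fun n => (Q n : Op N)) :=
    (isBoundedUnder_of ⟨0, mazurRatio_nonneg hQsa⟩ :
      IsBoundedUnder (· ≥ ·) atTop (mazurRatio j fun n => (Q n : Op N))).isCoboundedUnder_le
  have hKlim : Tendsto (fun n : ℕ => K / √(n : ℝ)) atTop (𝓝 0) :=
    tendsto_const_nhds.div_atTop (Real.tendsto_sqrt_atTop.comp tendsto_natCast_atTop_atTop)
  have hlim := (((tendsto_hsNorm_timeIntegral hh hj hj0 T).add hKlim).pow 2).div_const (T ^ 2)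
  have hpos : 0 ≤ squareIntegral (fun t => (currentCorr hh j t).re) T :=
    ge_of_tendsto' (tendsto_squareIntegral_chainCorr hh hj hj0 T) fun n => by
      rw [squareIntegral_chainCorr hh hj]
      positivity
  rw [add_zero, Real.sq_sqrt hpos] at hlim
  rw [← hlim.limsup_eq]
  refine limsup_le_limsup (hK.mono fun n hn => ?_) hcob hlim.isBoundedUnder_le
  rw [le_div_iff₀ (by positivity), mul_comm]
  exact sq_mul_mazurRatio_le hQsa hT.le hn

end Mazur

section PseudoLocal

variable {N d d' dj : ℕ} [NeZero N]

theorem hsNorm_observable (x : ℤ) (M : LocalMatrix N d) :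
    hsNorm (trace N) (observable x M) = hsNorm (trace N) (observable 0 M) := by
  have h := trace_observable_add_mul_observable M M.conjTranspose 0 0 x
  rw [zero_add] at h
  rw [hsNorm, hsNorm, ← StarHomClass.map_star (observable x),
    ← StarHomClass.map_star (observable 0), Matrix.star_eq_conjTranspose, h]

/-- Traceless observables on disjoint windows are orthogonal, so the weight may be placed where
`|x - y| ≤ d + d'`. -/
theorem norm_trace_observable_mul_observable_le {M : LocalMatrix N d}
    (hM : trace N (observable 0 M) = 0) (M' : LocalMatrix N d') {δ : ℝ} (hδ : 0 ≤ δ) (x y : ℤ) :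
    ‖trace N (observable x M * observable y M')‖ ≤
      hsNorm (trace N) (observable 0 M) * Real.exp (δ * d) *
        (hsNorm (trace N) (observable 0 M') * Real.exp (δ * d')) *
        Real.exp (-(δ * (|x - y| : ℤ))) := by
  have hM0 := hsNorm_nonneg (trace N) (observable 0 M)
  have hM0' := hsNorm_nonneg (trace N) (observable 0 M')
  by_cases hxy : DisjointWindows x d y d'
  · rw [trace_mul_observable_of_disjoint hxy, trace_observable x, ← trace_observable 0, hM,
      zero_mul, norm_zero]
    exact mul_nonneg (mul_nonneg (mul_nonneg hM0 (Real.exp_nonneg _))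
      (mul_nonneg hM0' (Real.exp_nonneg _))) (Real.exp_nonneg _)
  · have hdist : |x - y| ≤ (d : ℤ) + d' := by
      unfold DisjointWindows at hxy
      rw [abs_le]
      omega
    have hdist : ((|x - y| : ℤ) : ℝ) ≤ d + d' := by exact_mod_cast hdist
    calc ‖trace N (observable x M * observable y M')‖
        ≤ hsNorm (trace N) (observable 0 M) * hsNorm (trace N) (observable 0 M') := by
          rw [← hsNorm_observable x, ← hsNorm_observable y]
          exact isTracialState_trace.norm_apply_mul_le _ _
      _ ≤ hsNorm (trace N) (observable 0 M) * hsNorm (trace N) (observable 0 M') *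
            Real.exp (δ * d + δ * d' - δ * (|x - y| : ℤ)) :=
          le_mul_of_one_le_right (mul_nonneg hM0 hM0') (Real.one_le_exp (by nlinarith))
      _ = _ := by
          rw [sub_eq_add_neg, Real.exp_add, Real.exp_add]
          ring

theorem exists_tendsto_trace_chainSum_mul_chainSum {ι : Type*} {ℓ ℓ' : ι → ℕ}
    {M : ∀ i, LocalMatrix N (ℓ i)} (hM : ∀ i, trace N (observable 0 (M i)) = 0)
    {M' : ∀ i, LocalMatrix N (ℓ' i)} {s : ℕ → Finset ι}
    (hs : ∀ n, ∀ i ∉ s n, n < ℓ i ∨ n < ℓ' i) {δ : ℝ} (hδ : 0 < δ)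
    (hsum : Summable fun i => hsNorm (trace N) (observable 0 (M i)) * Real.exp (δ * ℓ i) *
      (hsNorm (trace N) (observable 0 (M' i)) * Real.exp (δ * ℓ' i))) :
    ∃ z, Tendsto (fun n : ℕ => 1 / (n : ℂ) *
      ∑ i ∈ s n, trace N (chainSum (M i) n * chainSum (M' i) n)) atTop (𝓝 z) := by
  have hg := hsum.mul_of_nonneg (summable_exp_neg_mul_abs hδ)
    (fun i => mul_nonneg (mul_nonneg (hsNorm_nonneg _ _) (Real.exp_nonneg _))
      (mul_nonneg (hsNorm_nonneg _ _) (Real.exp_nonneg _))) fun _ => Real.exp_nonneg _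
  refine ⟨_, (tendsto_pairAverage hs
    (c := fun _ i x y => trace N (observable x (M i) * observable y (M' i)))
    (w := fun p => trace N (observable p.2 (M p.1) * observable 0 (M' p.1))) hg
    (fun _ i x y => norm_trace_observable_mul_observable_le (hM i) (M' i) hδ.le x y)
    fun i z ε hε => ⟨0, fun n y _ _ => ?_⟩).congr fun n => ?_⟩
  · have h := trace_observable_add_mul_observable (M' i) (M i) z 0 y
    rw [zero_add, add_comm z y] at h
    rw [h, sub_self, norm_zero]
    exact hε.le
  · simp only [chainSum, Finset.sum_mul_sum, map_sum]

theorem hsNorm_observable_eq_sqrt {M : LocalMatrix N d} (hM : M.IsHermitian) (x : ℤ) :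
    hsNorm (trace N) (observable x M) = √(tracialState (place x M * place x M)).re := by
  rw [hsNorm, (isSelfAdjoint_observable x hM).star_eq, trace_apply]
  rfl

/-- Densities on `d + 1` sites, `d = 0, 1, …`, avoid the empty window, on which `IsPseudoLocal` says
nothing. -/
theorem exists_summable_density {Q : ℕ → QuasiLocal N}
    (hQ : IsPseudoLocal fun n => (Q n : Op N)) :
    ∃ (q : ∀ d : ℕ, LocalMatrix N (d + 1)) (δ : ℝ), 0 < δ ∧
      (∀ d, trace N (observable 0 (q d)) = 0) ∧
      (Summable fun d : ℕ =>
        hsNorm (trace N) (observable 0 (q d)) * Real.exp (δ * (d + 1 : ℕ))) ∧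
      ∀ n, Q n = ∑ d ∈ Finset.range n, chainSum (q d) n := by
  obtain ⟨q, ζ, ξ, hζ, hξ, hq, hQq⟩ := hQ
  refine ⟨fun d => q (d + 1), ξ / 4, by positivity, fun d => (hq (d + 1) (by omega)).2.1,
    Summable.of_nonneg_of_le (fun d => mul_nonneg (hsNorm_nonneg _ _) (Real.exp_nonneg _))
      (fun d => ?_) ((Real.summable_exp_nat_mul_iff.2 (by linarith : -(ξ / 4) < 0)).mul_left √ζ),
    fun n => Subtype.ext ?_⟩
  · obtain ⟨hherm, -, hdecay⟩ := hq (d + 1) (by omega)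
    calc hsNorm (trace N) (observable 0 (q (d + 1))) * Real.exp (ξ / 4 * (d + 1 : ℕ))
        ≤ √(ζ * Real.exp (-ξ * (d + 1 : ℕ))) * Real.exp (ξ / 4 * (d + 1 : ℕ)) := by
          rw [hsNorm_observable_eq_sqrt hherm]
          gcongr
      _ = √ζ * Real.exp ((d + 1 : ℕ) * -(ξ / 4)) := by
          rw [Real.sqrt_mul hζ.le, ← Real.exp_half, mul_assoc, ← Real.exp_add]
          ring_nf
      _ ≤ √ζ * Real.exp (d * -(ξ / 4)) := by
          refine mul_le_mul_of_nonneg_left (Real.exp_le_exp.2 ?_) (Real.sqrt_nonneg ζ)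
          push_cast
          linarith
  · have hcoe : ((∑ d ∈ Finset.range n, chainSum (q (d + 1)) n : QuasiLocal N) : Op N) =
        ∑ d ∈ Finset.range n, homogeneousSum (q (d + 1)) 1 n :=
      (map_sum (quasiLocalAlgebra N).subtype _ _).trans
        (Finset.sum_congr rfl fun d _ => coe_chainSum (q (d + 1)) n)
    refine (hQq n).trans (Eq.trans ?_ hcoe.symm)
    rw [Finset.range_eq_Ico, Finset.sum_Ico_add' (fun d => homogeneousSum (q d) 1 (n : ℤ))]
    rfl

theorem exists_tendsto_trace_chainSum_mul {j : LocalMatrix N dj}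
    (hj0 : trace N (observable 0 j) = 0) {Q : ℕ → QuasiLocal N}
    (hQ : IsPseudoLocal fun n => (Q n : Op N)) :
    ∃ z, Tendsto (fun n : ℕ => 1 / (n : ℂ) * trace N (chainSum j n * Q n)) atTop (𝓝 z) := by
  obtain ⟨q, δ, hδ, -, hsum, hQq⟩ := exists_summable_density hQ
  simp only [hQq, Finset.mul_sum _ _ (chainSum j _), map_sum]
  exact exists_tendsto_trace_chainSum_mul_chainSum (M := fun _ => j) (fun _ => hj0)
    (fun n d hd => Or.inr (by simpa [Nat.lt_succ_iff] using hd)) hδ (hsum.mul_left _)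

theorem exists_tendsto_trace_mul_self {Q : ℕ → QuasiLocal N}
    (hQ : IsPseudoLocal fun n => (Q n : Op N)) :
    ∃ z, Tendsto (fun n : ℕ => 1 / (n : ℂ) * trace N (Q n * Q n)) atTop (𝓝 z) := by
  obtain ⟨q, δ, hδ, hq0, hsum, hQq⟩ := exists_summable_density hQ
  have hnonneg (d : ℕ) :
      0 ≤ hsNorm (trace N) (observable 0 (q d)) * Real.exp (δ * (d + 1 : ℕ)) :=
    mul_nonneg (hsNorm_nonneg _ _) (Real.exp_nonneg _)
  simp only [hQq, Finset.sum_mul_sum, map_sum, ← Finset.sum_product']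
  refine exists_tendsto_trace_chainSum_mul_chainSum (M := fun i : ℕ × ℕ => q i.1)
    (M' := fun i => q i.2) (fun i => hq0 i.1) (fun n i hi => ?_) hδ
    (hsum.mul_of_nonneg hsum hnonneg hnonneg)
  simp only [Finset.mem_product, Finset.mem_range] at hi
  omega

theorem exists_real_tendsto_trace_mul {A B : ℕ → QuasiLocal N} (hA : ∀ n, IsSelfAdjoint (A n))
    (hB : ∀ n, IsSelfAdjoint (B n))
    (hlim : ∃ z, Tendsto (fun n : ℕ => 1 / (n : ℂ) * trace N (A n * B n)) atTop (𝓝 z)) :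
    ∃ r : ℝ, Tendsto (fun n : ℕ => 1 / (n : ℂ) * trace N (A n * B n)) atTop (𝓝 (r : ℂ)) := by
  obtain ⟨z, hz⟩ := hlim
  refine ⟨z.re, ((Complex.continuous_ofReal.tendsto _).comp
    ((Complex.continuous_re.tendsto z).comp hz)).congr fun n => ?_⟩
  rw [Function.comp_apply, Function.comp_apply, ← Complex.conj_eq_iff_re, map_mul,
    Complex.conj_eq_iff_im.2 (isTracialState_trace.im_apply_mul_eq_zero (hA n) (hB n))]
  simp

theorem tendsto_mazurRatio {j : LocalMatrix N dj} {Q : ℕ → Op N} {r χ : ℝ}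
    (hr : Tendsto (fun n : ℕ => 1 / (n : ℂ) * tracialState (homogeneousSum j 1 n * Q n)) atTop
      (𝓝 (r : ℂ)))
    (hχ : Tendsto (fun n : ℕ => 1 / (n : ℂ) * tracialState (Q n * Q n)) atTop (𝓝 (χ : ℂ)))
    (hχ0 : χ ≠ 0) : Tendsto (mazurRatio j Q) atTop (𝓝 (r ^ 2 / χ)) := by
  have hre (n : ℕ) (u : ℂ) : (1 / (n : ℂ) * u).re = 1 / n * u.re := by
    rw [← Complex.re_ofReal_mul]
    push_cast
    rfl
  have hr' := (Complex.continuous_re.tendsto _).comp hr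
  have hχ' := (Complex.continuous_re.tendsto _).comp hχ
  refine ((hr'.pow 2).div hχ' hχ0).congr' ?_
  filter_upwards [eventually_gt_atTop 0] with n hn
  have hn0 : (n : ℝ) ≠ 0 := by exact_mod_cast hn.ne'
  simp only [Function.comp_apply, hre, mazurRatio, Pi.div_apply]
  rw [mul_pow, mul_div_mul_comm, sq (1 / (n : ℝ)), mul_div_cancel_right₀ _ (one_div_ne_zero hn0)]

theorem exists_pseudoLocal_limits {j : LocalMatrix N dj} (hj : j.IsHermitian)
    (hj0 : trace N (observable 0 j) = 0) {Q : ℕ → QuasiLocal N} (hQsa : ∀ n, IsSelfAdjoint (Q n))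
    (hQ : IsPseudoLocal fun n => (Q n : Op N)) :
    ∃ r χ : ℝ,
      Tendsto (fun n : ℕ => 1 / (n : ℂ) * tracialState (homogeneousSum j 1 n * (Q n : Op N)))
        atTop (𝓝 (r : ℂ)) ∧
      Tendsto (fun n : ℕ => 1 / (n : ℂ) * tracialState ((Q n : Op N) * (Q n : Op N))) atTop
        (𝓝 (χ : ℂ)) ∧
      (χ ≠ 0 → Tendsto (mazurRatio j fun n => (Q n : Op N)) atTop (𝓝 (r ^ 2 / χ))) := by
  obtain ⟨r, hr⟩ := exists_real_tendsto_trace_mul (isSelfAdjoint_chainSum hj) hQsa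
    (exists_tendsto_trace_chainSum_mul hj0 hQ)
  obtain ⟨χ, hχ⟩ := exists_real_tendsto_trace_mul hQsa hQsa (exists_tendsto_trace_mul_self hQ)
  have hr : Tendsto (fun n : ℕ => 1 / (n : ℂ) *
      tracialState (homogeneousSum j 1 n * (Q n : Op N))) atTop (𝓝 (r : ℂ)) :=
    hr.congr fun n => by rw [← coe_chainSum]; rfl
  exact ⟨r, χ, hr, hχ, tendsto_mazurRatio hr hχ⟩

end PseudoLocal

end SpinChain

end

theorem mainTheorem7_general (N : ℕ) [NeZero N] (dh dj : ℕ)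
    (h : LocalMatrix N dh) (hh : h.IsHermitian)
    (j : LocalMatrix N dj) (hj : j.IsHermitian) (hj0 : tracialState (place 0 j) = 0)
    (Q : ℕ → Op N) (hQmem : ∀ n, Q n ∈ quasiLocalAlgebra N) (hQsa : ∀ n, IsSelfAdjoint (Q n))
    (hQ : IsAlmostConserved h Q) (β : ℝ) (hβ : 0 ≤ β) :
    (∀ t : ℝ, ∀ A ∈ quasiLocalAlgebra N,
      Tendsto (fun p : ℤ × ℤ => finiteEvolution h p.1 p.2 t A) (atBot ×ˢ atTop)
        (𝓝 (evolution h t A)) ∧ evolution h t A ∈ quasiLocalAlgebra N) ∧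
    ∃ (C : ℝ → ℝ) (D : ℝ),
      (∀ t : ℝ, Tendsto
        (fun n : ℕ => 1 / (n : ℂ) *
          tracialState (homogeneousSum j 1 n * evolution h t (homogeneousSum j 1 n)))
        atTop (𝓝 (C t : ℂ))) ∧
      (∀ t : ℝ, HasSum (fun x : ℤ => tracialState (place x j * evolution h t (place 0 j)))
        (C t : ℂ)) ∧
      Continuous C ∧
      Tendsto (fun t : ℝ => β / (2 * t) * ∫ s in (0 : ℝ)..t, C s) atTop (𝓝 D) ∧
      BddAbove (Set.range (mazurRatio j Q)) ∧
      β / 2 * limsup (mazurRatio j Q) atTop ≤ D ∧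
      (IsPseudoLocal Q → ∃ r χ : ℝ,
        Tendsto (fun n : ℕ => 1 / (n : ℂ) * tracialState (homogeneousSum j 1 n * Q n))
          atTop (𝓝 (r : ℂ)) ∧
        Tendsto (fun n : ℕ => 1 / (n : ℂ) * tracialState (Q n * Q n)) atTop (𝓝 (χ : ℂ)) ∧
        (χ ≠ 0 → Tendsto (mazurRatio j Q) atTop (𝓝 (r ^ 2 / χ)) ∧
          β / 2 * (r ^ 2 / χ) ≤ D)) := by
  obtain ⟨Q, rfl⟩ : ∃ Q' : ℕ → QuasiLocal N, Q = fun n => (Q' n : Op N) :=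
    ⟨fun n => ⟨Q n, hQmem n⟩, rfl⟩
  have hQsa (n : ℕ) : IsSelfAdjoint (Q n) := Subtype.ext (hQsa n)
  obtain ⟨D, hDsq, hD⟩ := exists_tendsto_timeAverage_currentCorr hh hj hj0
  have hlimsup : limsup (mazurRatio j fun n => (Q n : Op N)) atTop ≤ D :=
    ge_of_tendsto hDsq ((eventually_gt_atTop 0).mono fun T hT =>
      limsup_mazurRatio_le hQsa hh hj hj0 hQ hT)
  have hbound := mul_le_mul_of_nonneg_left hlimsup (by positivity : 0 ≤ β / 2)
  refine ⟨fun t A hA => ?_, fun t => (currentCorr hh j t).re, β / 2 * D, fun t => ?_, fun t => ?_,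
    Complex.continuous_re.comp (continuous_currentCorr hh hj0), ?_,
    bddAbove_mazurRatio hQsa hj hj0, hbound, fun hloc => ?_⟩
  · rw [← coe_flow hh t ⟨A, hA⟩]
    exact ⟨tendsto_finiteEvolution_flow hh t ⟨A, hA⟩, (flow hh t ⟨A, hA⟩).2⟩
  · rw [ofReal_re_currentCorr hh hj hj0]
    simp only [← coe_chainSum, ← coe_flow hh]
    exact tendsto_flow_chainSum hh hj0 t
  · rw [ofReal_re_currentCorr hh hj hj0, ← coe_observable, ← coe_flow hh]
    exact hasSum_currentCorr hh hj0 t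
  · exact (hD.const_mul (β / 2)).congr fun t => by rw [primitive]; ring
  · obtain ⟨r, χ, hr, hχ, hratio⟩ := exists_pseudoLocal_limits hj hj0 hQsa hloc
    exact ⟨r, χ, hr, hχ, fun hχ0 => ⟨hratio hχ0, (hratio hχ0).limsup_eq ▸ hbound⟩⟩

theorem mainTheorem7 (N : ℕ) [NeZero N] (dh dj : ℕ)
    (h : LocalMatrix N dh) (hh : h.IsHermitian)
    (j : LocalMatrix N dj) (hj : j.IsHermitian) (hj0 : tracialState (place 0 j) = 0)
    (Q : ℕ → Op N) (hQloc : ∀ n, Q n ∈ localAlgebra N 1 n) (hQsa : ∀ n, IsSelfAdjoint (Q n))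
    (hQ : IsAlmostConserved h Q) (β : ℝ) (hβ : 0 ≤ β) :
    -- the infinite-volume dynamics exists on the quasi-local algebra
    (∀ t : ℝ, ∀ A ∈ quasiLocalAlgebra N,
      Tendsto (fun p : ℤ × ℤ => finiteEvolution h p.1 p.2 t A) (atBot ×ˢ atTop)
        (𝓝 (evolution h t A)) ∧ evolution h t A ∈ quasiLocalAlgebra N) ∧
    ∃ (C : ℝ → ℝ) (D : ℝ),
      -- the current autocorrelation per site in the thermodynamic limit, at each fixed time
      (∀ t : ℝ, Tendsto
        (fun n : ℕ => 1 / (n : ℂ) *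
          tracialState (homogeneousSum j 1 n * evolution h t (homogeneousSum j 1 n)))
        atTop (𝓝 (C t : ℂ))) ∧
      (∀ t : ℝ, HasSum (fun x : ℤ => tracialState (place x j * evolution h t (place 0 j)))
        (C t : ℂ)) ∧
      Continuous C ∧
      -- the Drude weight: the time limit is taken afterwards
      Tendsto (fun t : ℝ => β / (2 * t) * ∫ s in (0 : ℝ)..t, C s) atTop (𝓝 D) ∧
      -- the Mazur bound
      BddAbove (Set.range (mazurRatio j Q)) ∧
      β / 2 * limsup (mazurRatio j Q) atTop ≤ D ∧
      -- for a pseudo-local extensive charge the limits exist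
      (IsPseudoLocal Q → ∃ r χ : ℝ,
        Tendsto (fun n : ℕ => 1 / (n : ℂ) * tracialState (homogeneousSum j 1 n * Q n))
          atTop (𝓝 (r : ℂ)) ∧
        Tendsto (fun n : ℕ => 1 / (n : ℂ) * tracialState (Q n * Q n)) atTop (𝓝 (χ : ℂ)) ∧
        (χ ≠ 0 → Tendsto (mazurRatio j Q) atTop (𝓝 (r ^ 2 / χ)) ∧
          β / 2 * (r ^ 2 / χ) ≤ D)) :=
  mainTheorem7_general N dh dj h hh j hj hj0 Q
    (fun n => let ⟨M, hM⟩ := hQloc n; hM ▸ place_mem_quasiLocalAlgebra 1 M) hQsa hQ β hβ
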